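/- **Theorem 5.2.** Let $n\in\{2,3\}$ and identify the hyperplane $\{x\in\mathbb R^n: x_n=0\}$ with $\mathbb R^{n-1}$. For $k>0$ and $s\in\mathbb R$ let $H^s(\mathbb R^{n-1})$ be the Bessel potential space of tempered distributions $u$ with $$\|u\|_{H^s_k(\mathbb R^{n-1})}^2:=\int_{\mathbb R^{n-1}}(k^2+|\xi|^2)^s|\hat u(\xi)|^2\,d\xi<\infty,$$ where $\hat u(\xi)=(2\pi)^{-(n-1)/2}\int e^{-i\xi\cdot x}u(x)\,dx$. For a non-empty bounded open set $\Gamma\subset\mathbb R^{n-1}$ (the screen) let $H^s_{\overline\Gamma}:=\{u\in H^s(\mathbb R^{n-1}):\operatorname{supp}u\subset\overline\Gamma\}$, and let $H^s(\Gamma)$ be the space of restrictions to $\Gamma$ of elements of $H^s(\mathbb R^{n-1})$, with norm $\|u\|_{H^s_k(\Gamma)}:=\inf\{\|U\|_{H^s_k(\mathbb R^{n-1})}: U\in H^s(\mathbb R^{n-1}),\ U|_\Gamma=u\}$. Let $\Phi(x,y)=\dfrac{e^{ik|x-y|}}{4\pi|x-y|}$ if $n=3$ and $\Phi(x,y)=\dfrac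 i4H^{(1)}_0(k|x-y|)$ if $n=2$. For a distribution $\phi$ on $\mathbb R^{n-1}$ with support in $\overline\Gamma$ let $\mathcal S_k\phi(x):=\langle\Phi(x,(\cdot,0)),\phi\rangle$ (bilinear pairing, $\Phi(x,(\cdot,0))$ being cut off outside a neighbourhood of $\overline\Gamma$), for $x\in\mathbb R^n\setminus(\overline\Gamma\times\{0\})$, be its single-layer potential, and let $S_k\phi$ be the common trace of $\mathcal S_k\phi$ on $\Gamma$ from both sides, i.e. the limit of $\mathcal S_k\phi(\cdot,t)$ as $t\to0^{\pm}$ in the sense of distributions on $\Gamma$; in particular $S_k\phi(x)=\int_\Gamma\Phi((x,0),(y,0))\phi(y)\,dy$ for $x\in\Gamma$ and $\phi\in C_0^\infty(\Gamma)$. Then for every $s\in\mathbb R$ the operator $S_k$ is well defined on $H^s_{\overline\Gamma}$ and is a bounded linear operator $S_k:H^s_{\overline\Gamma}\to H^{s+1}(\Gamma)$. Moreover, for every $n\in\{2,3\}$ and $s\in\mathbb R$ there exists a constant $C>0$, independent of $k$ and $\Gamma$, such that, for all $k>0$, all non-empty bounded open $\Gamma\subset\mathbb R^{n-1}$ and all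 $\phi\in H^s_{\overline\Gamma}$, with $L:=\operatorname{diam}\Gamma$, $$\|S_k\phi\|_{H^{s+1}_k(\Gamma)}\le\begin{cases}C\,(1+(kL)^{1/2})\,\|\phi\|_{H^s_k(\mathbb R^{n-1})},& n=3,\\ C\,\log(2+(kL)^{-1})\,(1+(kL)^{1/2})\,\|\phi\|_{H^s_k(\mathbb R^{n-1})},& n=2.\end{cases}$$ -/

import Mathlib

open MeasureTheory Filter Topology TopologicalSpace
open scoped SchwartzMap Distributions FourierTransform

noncomputable section

namespace ScreenScattering

/-! ### Bessel functions and the fundamental solution of the Helmholtz equation -/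

/-- The Bessel function of the first kind of order zero. -/
def besselJ0 (z : ℝ) : ℝ :=
  ∑' m : ℕ, (-1 : ℝ) ^ m * (z ^ 2 / 4) ^ m / (m.factorial : ℝ) ^ 2

/-- The Bessel function of the second kind of order zero, for `z > 0`. -/
def besselY0 (z : ℝ) : ℝ :=
  2 / Real.pi * ((Real.log (z / 2) + Real.eulerMascheroniConstant) * besselJ0 z +
    ∑' m : ℕ, (-1 : ℝ) ^ (m + 1) * (harmonic m : ℝ) * (z ^ 2 / 4) ^ m / (m.factorial : ℝ) ^ 2)

/-- The Hankel function of the first kind of order zero, `H₀⁽¹⁾(z) = J₀(z) + i Y₀(z)`. -/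
def hankelH0 (z : ℝ) : ℂ := (besselJ0 z : ℂ) + Complex.I * (besselY0 z : ℂ)

/-- The outgoing fundamental solution `Φ(x, y)` of the Helmholtz equation with wavenumber `k`
in dimension `n = 3` (first branch) or `n = 2` (second branch). -/
def fundamentalSolution {n : ℕ} (k : ℝ) (x y : EuclideanSpace ℝ (Fin n)) : ℂ :=
  if n = 3 then
    Complex.exp (Complex.I * (k * ‖x - y‖ : ℝ)) / (4 * Real.pi * ‖x - y‖ : ℝ)
  else
    Complex.I / 4 * hankelH0 (k * ‖x - y‖)

/-- The point `(x̃, t)` of `ℝᵈ⁺¹`; the hyperplane containing the screen is `{(x̃, 0)}`, and is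
identified with `ℝᵈ`. -/
def point {d : ℕ} (x : EuclideanSpace ℝ (Fin d)) (t : ℝ) : EuclideanSpace ℝ (Fin (d + 1)) :=
  WithLp.toLp 2 (Fin.snoc (α := fun _ => ℝ) (fun i => x i) t)

/-! ### Wavenumber-dependent Bessel potential spaces on `ℝᵈ` -/

section Sobolev

variable {E : Type*} [NormedAddCommGroup E] [InnerProductSpace ℝ E] [FiniteDimensional ℝ E]
  [MeasurableSpace E] [BorelSpace E]

/-- The Bessel potential operator `𝒥ₖˢ = (k² - Δ)^(s/2)`. Mathlib's Fourier transform has the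
kernel `exp (-2πi ξ·x)`, so the symbol `(k² + |ξ|²)^(s/2)` is taken at the point `2πξ`. -/
def besselPotential (k s : ℝ) : 𝓢'(E, ℂ) →L[ℂ] 𝓢'(E, ℂ) :=
  TemperedDistribution.fourierMultiplierCLM ℂ
    (fun ξ : E => (((k ^ 2 + (2 * Real.pi * ‖ξ‖) ^ 2) ^ (s / 2) : ℝ) : ℂ))

variable (E) in
/-- The Sobolev space `Hˢ(ℝᵈ)`: the tempered distributions `u` with `𝒥ₖˢ u ∈ L²`. -/
def sobolevSpace (k s : ℝ) : Submodule ℂ 𝓢'(E, ℂ) :=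
  (LinearMap.range
    (Lp.toTemperedDistributionCLM ℂ (volume : Measure E) 2).toLinearMap).comap
    (besselPotential k s).toLinearMap

theorem mem_sobolevSpace {k s : ℝ} {u : 𝓢'(E, ℂ)} :
    u ∈ sobolevSpace E k s ↔ ∃ f : Lp ℂ 2 (volume : Measure E), besselPotential k s u = f := by
  constructor
  · rintro ⟨f, hf⟩
    exact ⟨f, hf.symm⟩
  · rintro ⟨f, hf⟩
    exact ⟨f, hf.symm⟩

/-- The norm `‖u‖_{Hˢₖ(ℝᵈ)} = ‖𝒥ₖˢ u‖_{L²}`. -/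
def sobolevNorm {k s : ℝ} (u : sobolevSpace E k s) : ℝ := ‖(mem_sobolevSpace.1 u.2).choose‖

theorem sobolevNorm_eq {k s : ℝ} (u : sobolevSpace E k s) (f : Lp ℂ 2 (volume : Measure E))
    (hf : besselPotential k s (u : 𝓢'(E, ℂ)) = f) : sobolevNorm u = ‖f‖ := by
  have h := hf.symm.trans (mem_sobolevSpace.1 u.2).choose_spec
  have hk := Lp.ker_toTemperedDistributionCLM_eq_bot (F := ℂ) (μ := (volume : Measure E)) (p := 2)
  have := LinearMap.ker_eq_bot.1 hk h
  exact congrArg norm this.symm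

/-- The space `Hˢ_F` of those `u ∈ Hˢ(ℝᵈ)` with `supp u ⊆ F`, that is, those which vanish on the
complement of the closed set `F`. -/
def sobolevSupportedIn (k s : ℝ) (F : Set E) : Submodule ℂ (sobolevSpace E k s) where
  carrier := {u | Distribution.IsVanishingOn (u : 𝓢'(E, ℂ)) Fᶜ}
  add_mem' := by
    intro u v hu hv f hf
    have h1 := hu f hf
    have h2 := hv f hf
    simp only [Submodule.coe_add]
    change (u : 𝓢'(E, ℂ)) f + (v : 𝓢'(E, ℂ)) f = 0
    rw [h1, h2, add_zero]
  zero_mem' := by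
    intro f _
    rfl
  smul_mem' := by
    intro c u hu f hf
    have h1 := hu f hf
    change c • ((u : 𝓢'(E, ℂ)) f) = 0
    rw [h1, smul_zero]

/-! ### Distributions on an open set, and Sobolev spaces on it -/

/-- A real test function on `Ω`, as a complex Schwartz function on `ℝᵈ`. -/
def testToSchwartz {Ω : Opens E} (v : 𝓓(Ω, ℝ)) : 𝓢(E, ℂ) :=
  HasCompactSupport.toSchwartzMap (f := fun x => (v x : ℂ))
    (v.hasCompactSupport.comp_left (g := fun r : ℝ => (r : ℂ)) (by simp))
    (Complex.ofRealCLM.contDiff.comp v.contDiff)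

theorem continuous_testToSchwartz {Ω : Opens E} (K : Compacts E) (hK : (K : Set E) ⊆ Ω) :
    Continuous ((testToSchwartz : 𝓓(Ω, ℝ) → 𝓢(E, ℂ)) ∘ TestFunction.ofSupportedIn hK) := by
  let A : ContDiffMapSupportedIn E ℝ ⊤ K →ₗ[ℝ] 𝓢(E, ℂ) :=
    { toFun := fun f => testToSchwartz (TestFunction.ofSupportedIn hK f)
      map_add' := by
        intro f g
        ext x
        exact Complex.ofReal_add _ _
      map_smul' := by
        intro c f
        ext x
        exact Complex.ofReal_mul _ _ }
  change Continuous A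
  refine WithSeminorms.continuous_of_isBounded
    (ContDiffMapSupportedIn.withSeminorms ℝ E ℝ ⊤ K) (schwartz_withSeminorms ℝ E ℂ) A ?_
  rintro ⟨m, l⟩
  obtain ⟨R, hR⟩ := K.isCompact.isBounded.exists_norm_le
  have hR0 : 0 ≤ max R 0 := le_max_right _ _
  refine ⟨{l}, ⟨(max R 0) ^ m, pow_nonneg hR0 m⟩, fun f => ?_⟩
  refine SchwartzMap.seminorm_le_bound ℝ m l _ (by positivity) (fun x => ?_)
  have h1 : ‖iteratedFDeriv ℝ l (A f) x‖ = ‖iteratedFDeriv ℝ l f x‖ :=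
    Complex.ofRealLI.norm_iteratedFDeriv_comp_left
      (f := (f : E → ℝ)) f.contDiff.contDiffAt (by exact_mod_cast le_top)
  rw [h1]
  by_cases hx : x ∈ K
  · have h2 : ‖x‖ ^ m ≤ (max R 0) ^ m :=
      pow_le_pow_left₀ (norm_nonneg x) ((hR x hx).trans (le_max_left _ _)) m
    have h3 := ContDiffMapSupportedIn.norm_iteratedFDeriv_apply_le_seminorm_top ℝ
      (i := l) (f := f) (x := x)
    rw [Finset.sup_singleton]
    exact mul_le_mul h2 h3 (norm_nonneg _) (pow_nonneg hR0 m)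
  · rw [f.iteratedFDeriv_zero_on_compl hx]
    simp only [Pi.zero_apply, norm_zero, mul_zero]
    exact apply_nonneg _ _

variable (E) in
/-- The inclusion of the test functions on `Ω` into the Schwartz space. -/
def testToSchwartzCLM (Ω : Opens E) : 𝓓(Ω, ℝ) →L[ℝ] 𝓢(E, ℂ) :=
  TestFunction.mkCLM ℝ testToSchwartz
    (by
      intro f g
      ext x
      exact Complex.ofReal_add _ _)
    (by
      intro c f
      ext x
      exact Complex.ofReal_mul _ _)
    continuous_testToSchwartz

/-- The restriction `U|_Ω` of a tempered distribution to the open set `Ω`. -/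
def restrict (Ω : Opens E) : 𝓢'(E, ℂ) →ₗ[ℂ] 𝓓'(Ω, ℂ) where
  toFun U :=
    { toFun := fun v => U (testToSchwartzCLM E Ω v)
      map_add' := fun v w => by rw [map_add, map_add]
      map_smul' := fun c v => by
        rw [map_smul]
        exact map_smul U (c : ℂ) _
      cont := U.cont.comp (testToSchwartzCLM E Ω).continuous }
  map_add' _ _ := rfl
  map_smul' _ _ := rfl

/-- The Sobolev space `Hˢ(Ω)` of the restrictions to `Ω` of the elements of `Hˢ(ℝᵈ)`. -/
def sobolevOn (k s : ℝ) (Ω : Opens E) : Submodule ℂ 𝓓'(Ω, ℂ) :=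
  (sobolevSpace E k s).map (restrict Ω)

/-- The norm of `Hˢₖ(Ω)`: the infimum of `‖U‖_{Hˢₖ(ℝᵈ)}` over all extensions `U` of `u`. -/
def sobolevOnNorm {k s : ℝ} {Ω : Opens E} (u : sobolevOn k s Ω) : ℝ :=
  sInf {r : ℝ | ∃ U : sobolevSpace E k s,
    restrict Ω (U : 𝓢'(E, ℂ)) = (u : 𝓓'(Ω, ℂ)) ∧ sobolevNorm U = r}

end Sobolev

/-! ### The single-layer potential and the single-layer boundary integral operator -/

section SingleLayer

variable {d : ℕ}

open Classical in
/-- The single-layer potential `𝒮ₖφ(x) = ⟨Φ(x, ·), φ⟩` at a point `x` of `ℝᵈ⁺¹` off the closure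
of the screen `Γ`, for a density `φ` supported in the closure of `Γ`: the distribution `φ` is
applied to any Schwartz function (such as `ρ Φ(x, ·)` with a cut-off function `ρ`) which
coincides with `Φ(x, ·)` in a neighbourhood of the closure of `Γ`; see
`singleLayerPotential_eq` for the independence of the choice. -/
def singleLayerPotential (k : ℝ) (Γ : Opens (EuclideanSpace ℝ (Fin d)))
    (φ : 𝓢'(EuclideanSpace ℝ (Fin d), ℂ)) (x : EuclideanSpace ℝ (Fin (d + 1))) : ℂ :=
  if h : ∃ f : 𝓢(EuclideanSpace ℝ (Fin d), ℂ),
      ∀ᶠ y in 𝓝ˢ (closure (Γ : Set (EuclideanSpace ℝ (Fin d)))),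
        f y = fundamentalSolution k x (point y 0)
  then φ h.choose
  else 0

theorem singleLayerPotential_eq {k : ℝ} {Γ : Opens (EuclideanSpace ℝ (Fin d))}
    {φ : 𝓢'(EuclideanSpace ℝ (Fin d), ℂ)}
    (hφ : Distribution.IsVanishingOn φ (closure (Γ : Set (EuclideanSpace ℝ (Fin d))))ᶜ)
    {x : EuclideanSpace ℝ (Fin (d + 1))} {f : 𝓢(EuclideanSpace ℝ (Fin d), ℂ)}
    (hf : ∀ᶠ y in 𝓝ˢ (closure (Γ : Set (EuclideanSpace ℝ (Fin d)))),
      f y = fundamentalSolution k x (point y 0)) :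
    singleLayerPotential k Γ φ x = φ f := by
  have h : ∃ f : 𝓢(EuclideanSpace ℝ (Fin d), ℂ),
      ∀ᶠ y in 𝓝ˢ (closure (Γ : Set (EuclideanSpace ℝ (Fin d)))),
        f y = fundamentalSolution k x (point y 0) := ⟨f, hf⟩
  have key : φ (h.choose - f) = 0 := by
    apply hφ
    intro y hy hyΓ
    have h1 : ∀ᶠ z in 𝓝 y, (h.choose - f) z = 0 := by
      have h2 := (h.choose_spec.and hf).filter_mono (nhds_le_nhdsSet hyΓ)
      filter_upwards [h2] with z hz
      simp [hz.1, hz.2]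
    exact (notMem_tsupport_iff_eventuallyEq.2 h1) hy
  rw [map_sub, sub_eq_zero] at key
  rw [singleLayerPotential, dif_pos h, key]

/-- `u = Sₖφ`: the distribution `u` on the screen `Γ` is the common trace on `Γ`, from above and
from below, of the single-layer potential of `φ`. As `φ` may be an arbitrarily rough distribution,
the trace is taken in the sense of distributions on `Γ`, as the limit of the restrictions of the
potential to the parallel hyperplanes at height `t`, when `t` tends to zero from either side; the
limit `u` is unique. -/
def IsSingleLayerTrace (k : ℝ) (Γ : Opens (EuclideanSpace ℝ (Fin d)))
    (φ : 𝓢'(EuclideanSpace ℝ (Fin d), ℂ)) (u : 𝓓'(Γ, ℂ)) : Prop :=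
  ∀ v : 𝓓(Γ, ℝ),
    Tendsto (fun t : ℝ => ∫ x, (v x : ℂ) * singleLayerPotential k Γ φ (point x t))
        (𝓝[>] 0) (𝓝 (u v)) ∧
      Tendsto (fun t : ℝ => ∫ x, (v x : ℂ) * singleLayerPotential k Γ φ (point x t))
        (𝓝[<] 0) (𝓝 (u v))

/-- The factor in the norm bound, as a function of `z = k L`, for screens in `ℝᵈ⁺¹`: the first
branch is for three space dimensions, the second for two. -/
def boundFactor (d : ℕ) (z : ℝ) : ℝ :=
  if d = 2 then 1 + z ^ (1 / 2 : ℝ) else Real.log (2 + z⁻¹) * (1 + z ^ (1 / 2 : ℝ))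

end SingleLayer

end ScreenScattering

end

/-!
The closure of the screen has diameter `L`, so on the screen the single-layer potential at height
`t` is the convolution of the density with a kernel which is cut off beyond the distance `L`
(`truncatedKernel`). For `t ≠ 0` this kernel is smooth with compact support, and the convolution is
the Fourier multiplier whose symbol is the Fourier transform of the kernel. As `t` tends to zero,
the kernels are dominated by an integrable function and converge off the origin, so their Fourier
transforms converge boundedly; hence the potentials of a density in `Hˢ`, whose Fourier transform is
a weighted square-integrable function, converge in the sense of distributions on the screen to the
Fourier multiplier belonging to the kernel at height zero. This is `exists_singleLayer_operator`. It
reduces the theorem, for all `s` at once, to the bound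
`|𝓕 K(ξ)| (k² + |2πξ|²)^(1/2) ≤ C boundFactor (k L)` for the truncated fundamental solution `K` on
the hyperplane, which is `exists_bound_symbol`.

As `K` is radial, `𝓕 K(ξ)` is a one-dimensional integral over the rescaled radius `r ∈ [0, 2]`. Put
`κ = k L` and `a = 2π|ξ| L`. Up to constants, the integrand is `χ(r) e^{iκr} J(a r)` in the plane,
where `J = 2π J₀` is the angular average of a plane wave, and `χ(r) H₀⁽¹⁾(κ r) cos (a r)` on the
line. What is needed is a bound of the integral by a multiple of `(1 + √κ) / max κ a`, with a factor
`log (2 + 1/κ)` on the line.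

In the plane one integrates by parts once: the exponential if `a ≤ κ`, and the factor `J(a r)`,
which has a primitive decaying like `z^(-1/2)` (`exists_primitive_waveAverage`), if `κ ≤ a`. The
integrals that remain carry a factor `κ (a r)^(-1/2)` or `a (a r)^(-1/2)` at most, whence `√κ`. On
the line the decay `|H₀⁽¹⁾(z)| ≤ C z^(-1/2)` suffices if `a ≤ κ`. If `κ ≤ a` one integrates the
cosine; the derivative of `H₀⁽¹⁾` is `c / z`, which leads to a bounded truncated sine integral, plus
an error of size `z^(-1/2)` (`exists_norm_hankelH0Deriv_sub_le`), and the logarithm comes from the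
derivative of the cut-off function.

The decay of Bessel functions is obtained from the differential equation alone, by the energy
estimate `besselEnergy_antitoneOn`; it does not need their asymptotic expansions.
-/

noncomputable section

namespace ScreenScattering

/-! ### Decay of solutions of Bessel's equation of order zero -/

/-- For a solution `y` of Bessel's equation, `w = √z y` solves `w'' + (1 + 1 / (4 z²)) w = 0`. The
function below is its energy `(w')² + (1 + 1 / (4 z²)) w²`, which decreases with the coefficient. -/
theorem besselEnergy_antitoneOn {y y' : ℝ → ℝ} (hy : ∀ z > 0, HasDerivAt y (y' z) z)
    (hy' : ∀ z > 0, HasDerivAt y' (-(y' z / z) - y z) z) :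
    AntitoneOn (fun z => z * (y z ^ 2 + y' z ^ 2) + y z * y' z + y z ^ 2 / (2 * z))
      (Set.Ici 1) := by
  have hd : ∀ z > 0, HasDerivAt
      (fun z => z * (y z ^ 2 + y' z ^ 2) + y z * y' z + y z ^ 2 / (2 * z))
      (-(y z ^ 2 / (2 * z ^ 2))) z := by
    intro z hz
    have h1 := ((hasDerivAt_id z).mul (((hy z hz).pow 2).add ((hy' z hz).pow 2))).add
      ((hy z hz).mul (hy' z hz))
    have h2 := h1.add (((hy z hz).pow 2).div ((hasDerivAt_id z).const_mul 2)
      (by simpa using hz.ne'))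
    refine h2.congr_deriv ?_
    simp only [id, Pi.add_apply, Pi.pow_apply]
    field_simp
    ring
  refine antitoneOn_of_deriv_nonpos (convex_Ici 1) ?_ ?_ ?_
  · intro z hz
    exact (hd z (lt_of_lt_of_le one_pos hz)).continuousAt.continuousWithinAt
  · intro z hz
    rw [interior_Ici] at hz
    exact (hd z (one_pos.trans hz)).differentiableAt.differentiableWithinAt
  · intro z hz
    rw [interior_Ici] at hz
    rw [(hd z (one_pos.trans hz)).deriv]
    have : 0 ≤ y z ^ 2 / (2 * z ^ 2) := by positivity
    linarith

/-- The real case of `exists_bessel_decay`. -/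
theorem exists_bessel_decay_real {y y' : ℝ → ℝ} (hy : ∀ z > 0, HasDerivAt y (y' z) z)
    (hy' : ∀ z > 0, HasDerivAt y' (-(y' z / z) - y z) z) :
    ∃ C : ℝ, 0 ≤ C ∧ ∀ z, 1 ≤ z →
      |y z| ≤ C * z ^ (-(1 / 2) : ℝ) ∧ |y' z| ≤ C * z ^ (-(1 / 2) : ℝ) := by
  set A : ℝ := 1 * (y 1 ^ 2 + y' 1 ^ 2) + y 1 * y' 1 + y 1 ^ 2 / (2 * 1) with hA
  refine ⟨√(2 * A), Real.sqrt_nonneg _, fun z hz => ?_⟩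
  have hz0 : 0 < z := by linarith
  have h1 := besselEnergy_antitoneOn hy hy' (Set.mem_Ici.2 le_rfl) (Set.mem_Ici.2 hz) hz
  simp only at h1
  rw [← hA] at h1
  have h2 : 0 ≤ y z ^ 2 / (2 * z) := by positivity
  have h3 : z * (y z ^ 2 + y' z ^ 2) ≤ 2 * A := by
    nlinarith [sq_nonneg (y z + y' z), sq_nonneg (y z - y' z), sq_nonneg (y z), sq_nonneg (y' z)]
  have h4 : √(2 * A) * z ^ (-(1 / 2) : ℝ) = √(2 * A / z) := by
    rw [Real.sqrt_div' _ hz0.le, Real.rpow_neg hz0.le, ← Real.sqrt_eq_rpow, div_eq_mul_inv]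
  have h5 : y z ^ 2 + y' z ^ 2 ≤ 2 * A / z := by
    rw [le_div_iff₀ hz0]; linarith
  rw [h4]
  exact ⟨Real.abs_le_sqrt (by nlinarith [sq_nonneg (y' z)]),
    Real.abs_le_sqrt (by nlinarith [sq_nonneg (y z)])⟩

/-- Solutions of Bessel's equation `y'' + y' / z + y = 0` and their derivatives decay like
`z ^ (-1/2)`, because the energy of `√z y` (see `besselEnergy_antitoneOn`) does not increase. -/
theorem exists_bessel_decay {y y' : ℝ → ℂ} (hy : ∀ z > 0, HasDerivAt y (y' z) z)
    (hy' : ∀ z > 0, HasDerivAt y' (-(y' z / z) - y z) z) :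
    ∃ C : ℝ, 0 ≤ C ∧ ∀ z, 1 ≤ z →
      ‖y z‖ ≤ C * z ^ (-(1 / 2) : ℝ) ∧ ‖y' z‖ ≤ C * z ^ (-(1 / 2) : ℝ) := by
  obtain ⟨C₁, h₁, H₁⟩ := exists_bessel_decay_real (y := fun z => (y z).re)
    (y' := fun z => (y' z).re)
    (fun z hz => Complex.reCLM.hasFDerivAt.comp_hasDerivAt z (hy z hz))
    (fun z hz => by
      refine (Complex.reCLM.hasFDerivAt.comp_hasDerivAt z (hy' z hz)).congr_deriv ?_
      simp [Complex.div_ofReal_re])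
  obtain ⟨C₂, h₂, H₂⟩ := exists_bessel_decay_real (y := fun z => (y z).im)
    (y' := fun z => (y' z).im)
    (fun z hz => Complex.imCLM.hasFDerivAt.comp_hasDerivAt z (hy z hz))
    (fun z hz => by
      refine (Complex.imCLM.hasFDerivAt.comp_hasDerivAt z (hy' z hz)).congr_deriv ?_
      simp [Complex.div_ofReal_im])
  refine ⟨C₁ + C₂, by positivity, fun z hz => ⟨?_, ?_⟩⟩
  · refine (Complex.norm_le_abs_re_add_abs_im _).trans ?_
    linarith [(H₁ z hz).1, (H₂ z hz).1]
  · refine (Complex.norm_le_abs_re_add_abs_im _).trans ?_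
    linarith [(H₁ z hz).2, (H₂ z hz).2]

theorem one_le_rpow_neg_half {z : ℝ} (hz : 0 < z) (hz1 : z ≤ 1) :
    1 ≤ z ^ (-(1 / 2) : ℝ) :=
  Real.one_le_rpow_of_pos_of_le_one_of_nonpos hz hz1 (by norm_num)

/-! ### Entire power series with factorially small coefficients -/

/-- Coefficient sequences of entire functions of exponential type one; the class is closed under
differentiation of the power series. -/
def FactorialBound (a : ℕ → ℝ) : Prop := ∀ m, |a m| ≤ 1 / (m.factorial : ℝ)

/-- The coefficients of the derivative of a power series. -/
def derivCoeff (a : ℕ → ℝ) (m : ℕ) : ℝ := (m + 1) * a (m + 1)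

/-- The sum of the power series with coefficients `a`. -/
def entireSum (a : ℕ → ℝ) (x : ℝ) : ℝ := ∑' m, a m * x ^ m

protected theorem FactorialBound.derivCoeff {a : ℕ → ℝ} (ha : FactorialBound a) :
    FactorialBound (ScreenScattering.derivCoeff a) := by
  intro m
  have h := ha (m + 1)
  have h1 : (0 : ℝ) < m + 1 := by positivity
  have h2 : (0 : ℝ) < m.factorial := by positivity
  rw [ScreenScattering.derivCoeff, abs_mul, abs_of_pos h1]
  calc ((m : ℝ) + 1) * |a (m + 1)| ≤ (m + 1) * (1 / ((m + 1).factorial : ℝ)) := by gcongr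
    _ = 1 / (m.factorial : ℝ) := by
      rw [Nat.factorial_succ]; push_cast; field_simp

protected theorem FactorialBound.summable {a : ℕ → ℝ} (ha : FactorialBound a) (x : ℝ) :
    Summable fun m => a m * x ^ m := by
  refine Summable.of_norm_bounded (Real.summable_pow_div_factorial |x|) fun m => ?_
  rw [norm_mul, norm_pow, Real.norm_eq_abs, Real.norm_eq_abs]
  calc |a m| * |x| ^ m ≤ 1 / (m.factorial : ℝ) * |x| ^ m := by gcongr; exact ha m
    _ = _ := by ring

protected theorem FactorialBound.hasDerivAt {a : ℕ → ℝ} (ha : FactorialBound a) (x : ℝ) :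
    HasDerivAt (entireSum a) (entireSum (ScreenScattering.derivCoeff a) x) x := by
  have hR : 0 ≤ |x| + 1 := by positivity
  have key : HasDerivAt (fun z => ∑' m, a m * z ^ m) (∑' m, a m * (m * x ^ (m - 1))) x := by
    refine hasDerivAt_tsum_of_isPreconnected
      (u := fun m : ℕ => (m : ℝ) * (|x| + 1) ^ (m - 1) / m.factorial) (t := Metric.ball 0 (|x| + 1))
      ?_ Metric.isOpen_ball
      (convex_ball _ _).isPreconnected (fun m y _ => (hasDerivAt_pow m y).const_mul (a m)) ?_
      (y₀ := 0) (by simpa using (by positivity : 0 < |x| + 1)) (ha.summable 0)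
      (by rw [mem_ball_zero_iff, Real.norm_eq_abs]; linarith)
    · rw [← summable_nat_add_iff 1]
      refine (Real.summable_pow_div_factorial (|x| + 1)).congr fun m => ?_
      rw [Nat.factorial_succ]
      push_cast
      have : (m.factorial : ℝ) ≠ 0 := by positivity
      have : (m : ℝ) + 1 ≠ 0 := by positivity
      field_simp
    · intro m y hy
      have hy' : |y| ≤ |x| + 1 := by
        rw [mem_ball_zero_iff, Real.norm_eq_abs] at hy
        exact hy.le
      rw [norm_mul, norm_mul, norm_pow, Real.norm_eq_abs, Real.norm_eq_abs, Real.norm_eq_abs,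
        Nat.abs_cast]
      calc |a m| * (m * |y| ^ (m - 1)) ≤ 1 / (m.factorial : ℝ) * (m * (|x| + 1) ^ (m - 1)) := by
            gcongr; exact ha m
        _ = _ := by ring
  have hs : Summable fun m => a m * (m * x ^ (m - 1)) := by
    rw [← summable_nat_add_iff 1]
    refine (ha.derivCoeff.summable x).congr fun m => ?_
    simp only [derivCoeff, Nat.add_sub_cancel]; push_cast; ring
  refine key.congr_deriv ?_
  rw [hs.tsum_eq_zero_add]
  simp only [CharP.cast_eq_zero, zero_mul, mul_zero, zero_add, entireSum, derivCoeff]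
  refine tsum_congr fun m => ?_
  simp only [Nat.add_sub_cancel]; push_cast; ring

protected theorem FactorialBound.contDiff {a : ℕ → ℝ} (ha : FactorialBound a) (n : ℕ) :
    ContDiff ℝ n (entireSum a) := by
  induction n generalizing a with
  | zero =>
    exact contDiff_zero.2 (continuous_iff_continuousAt.2 fun x => (ha.hasDerivAt x).continuousAt)
  | succ n ih =>
    push_cast
    refine contDiff_succ_iff_deriv.2 ⟨fun x => (ha.hasDerivAt x).differentiableAt, by simp, ?_⟩
    rw [show deriv (entireSum a) = entireSum (derivCoeff a) from
      funext fun x => (ha.hasDerivAt x).deriv]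
    exact ih ha.derivCoeff

protected theorem FactorialBound.continuous {a : ℕ → ℝ} (ha : FactorialBound a) :
    Continuous (entireSum a) := (ha.contDiff 0).continuous

/-! ### The Bessel functions `J₀` and `Y₀` -/

/-- `J₀(z) = ∑ cₘ (z²/4)ᵐ` with these coefficients `cₘ`. -/
def coeffJ (m : ℕ) : ℝ := (-1) ^ m / (m.factorial : ℝ) ^ 2

/-- The regular part of `(π / 2) Y₀(z)` is `∑ cₘ (z²/4)ᵐ` with these coefficients `cₘ`. -/
def coeffY (m : ℕ) : ℝ := (-1) ^ (m + 1) * (harmonic m : ℝ) / (m.factorial : ℝ) ^ 2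

theorem factorialBound_coeffJ : FactorialBound coeffJ := by
  intro m
  have h : (1 : ℝ) ≤ m.factorial := by exact_mod_cast m.factorial_pos
  rw [coeffJ, abs_div, abs_pow, abs_neg, abs_one, one_pow, abs_of_nonneg (by positivity)]
  gcongr
  nlinarith

theorem harmonic_le_self (m : ℕ) : harmonic m ≤ m := by
  induction m with
  | zero => simp
  | succ m ih =>
    rw [harmonic_succ]
    push_cast
    have : ((m : ℚ) + 1)⁻¹ ≤ 1 :=
      inv_le_one_of_one_le₀ (by linarith [(Nat.cast_nonneg m : (0 : ℚ) ≤ m)])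
    linarith

theorem harmonic_nonneg_rat (m : ℕ) : 0 ≤ harmonic m := by
  rw [harmonic]; positivity

theorem factorialBound_coeffY : FactorialBound coeffY := by
  intro m
  have h : (0 : ℝ) < m.factorial := by positivity
  have h0 : (0 : ℝ) ≤ (harmonic m : ℝ) := by exact_mod_cast harmonic_nonneg_rat m
  have h1 : (harmonic m : ℝ) ≤ m.factorial := by
    have h2 : ((harmonic m : ℚ) : ℝ) ≤ ((m : ℚ) : ℝ) := by exact_mod_cast harmonic_le_self m
    have h3 : (m : ℝ) ≤ m.factorial := by exact_mod_cast m.self_le_factorial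
    push_cast at h2
    linarith
  rw [coeffY, abs_div, abs_mul, abs_pow, abs_neg, abs_one, one_pow, one_mul, abs_of_nonneg h0,
    abs_of_nonneg (by positivity), div_le_div_iff₀ (by positivity) h]
  nlinarith

theorem besselJ0_eq (z : ℝ) : besselJ0 z = entireSum coeffJ (z ^ 2 / 4) := by
  rw [besselJ0, entireSum]
  exact tsum_congr fun m => by rw [coeffJ]; ring

theorem besselY0_eq (z : ℝ) : besselY0 z =
    2 / Real.pi * ((Real.log (z / 2) + Real.eulerMascheroniConstant) * entireSum coeffJ (z ^ 2 / 4)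
      + entireSum coeffY (z ^ 2 / 4)) := by
  rw [besselY0, besselJ0_eq]
  congr 2
  rw [entireSum]
  exact tsum_congr fun m => by rw [coeffY]; ring

/-- Comparing coefficients in the equation `x f'' + f' + f = g`, which becomes Bessel's equation of
order zero under `x = z² / 4`. -/
theorem entireSum_recurrence {a b : ℕ → ℝ} (ha : FactorialBound a)
    (h : ∀ m : ℕ, ((m : ℝ) + 1) ^ 2 * a (m + 1) + a m = b m) (x : ℝ) :
    x * entireSum (derivCoeff (derivCoeff a)) x + entireSum (derivCoeff a) x + entireSum a x =
      entireSum b x := by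
  have hs1 : Summable fun m : ℕ => (m : ℝ) * derivCoeff a m * x ^ m := by
    rw [← summable_nat_add_iff 1]
    refine ((ha.derivCoeff.derivCoeff.summable x).mul_left x).congr fun m => ?_
    simp only [derivCoeff]; push_cast; ring
  have h1 : x * entireSum (derivCoeff (derivCoeff a)) x =
      ∑' m : ℕ, (m : ℝ) * derivCoeff a m * x ^ m := by
    rw [hs1.tsum_eq_zero_add, entireSum, ← tsum_mul_left]
    simp only [CharP.cast_eq_zero, zero_mul, zero_add]
    exact tsum_congr fun m => by simp only [derivCoeff]; push_cast; ring
  rw [h1, entireSum, entireSum, entireSum, ← hs1.tsum_add (ha.derivCoeff.summable x),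
    ← (hs1.add (ha.derivCoeff.summable x)).tsum_add (ha.summable x)]
  refine tsum_congr fun m => ?_
  rw [← h m, derivCoeff]
  ring

theorem FactorialBound.hasDerivAt_comp_sq {a : ℕ → ℝ} (ha : FactorialBound a) (z : ℝ) :
    HasDerivAt (fun z => entireSum a (z ^ 2 / 4))
      (z / 2 * entireSum (ScreenScattering.derivCoeff a) (z ^ 2 / 4)) z := by
  have h := (ha.hasDerivAt (z ^ 2 / 4)).comp z ((hasDerivAt_pow 2 z).div_const 4)
  refine h.congr_deriv ?_
  push_cast
  ring

theorem FactorialBound.hasDerivAt_deriv_comp_sq {a : ℕ → ℝ} (ha : FactorialBound a) (z : ℝ) :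
    HasDerivAt (fun z => z / 2 * entireSum (ScreenScattering.derivCoeff a) (z ^ 2 / 4))
      (1 / 2 * entireSum (ScreenScattering.derivCoeff a) (z ^ 2 / 4) + z ^ 2 / 4 *
        entireSum (ScreenScattering.derivCoeff (ScreenScattering.derivCoeff a)) (z ^ 2 / 4)) z := by
  have h := ((hasDerivAt_id z).div_const 2).mul (ha.derivCoeff.hasDerivAt_comp_sq z)
  refine h.congr_deriv ?_
  simp only [id]
  ring

theorem entireSum_coeffJ_recurrence (x : ℝ) :
    x * entireSum (derivCoeff (derivCoeff coeffJ)) x + entireSum (derivCoeff coeffJ) x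
      + entireSum coeffJ x = 0 := by
  rw [entireSum_recurrence factorialBound_coeffJ (b := fun _ => 0)]
  · simp [entireSum]
  · intro m
    have : (m.factorial : ℝ) ≠ 0 := by positivity
    have : (m : ℝ) + 1 ≠ 0 := by positivity
    rw [coeffJ, coeffJ, Nat.factorial_succ]
    push_cast
    field_simp
    ring

theorem entireSum_coeffY_recurrence (x : ℝ) :
    x * entireSum (derivCoeff (derivCoeff coeffY)) x + entireSum (derivCoeff coeffY) x
      + entireSum coeffY x = -entireSum (derivCoeff coeffJ) x := by
  rw [entireSum_recurrence factorialBound_coeffY (b := fun m => -derivCoeff coeffJ m)]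
  · simp [entireSum, tsum_neg]
  · intro m
    have : (m.factorial : ℝ) ≠ 0 := by positivity
    have : (m : ℝ) + 1 ≠ 0 := by positivity
    rw [derivCoeff, coeffJ, coeffY, coeffY, Nat.factorial_succ, harmonic_succ]
    push_cast
    field_simp
    ring

/-- The derivative of `besselJ0`. -/
def besselJ0Deriv (z : ℝ) : ℝ := z / 2 * entireSum (derivCoeff coeffJ) (z ^ 2 / 4)

/-- The derivative of `besselY0` on the positive half-line. -/
def besselY0Deriv (z : ℝ) : ℝ :=
  2 / Real.pi * (besselJ0 z / z + (Real.log (z / 2) + Real.eulerMascheroniConstant) *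
    besselJ0Deriv z + z / 2 * entireSum (derivCoeff coeffY) (z ^ 2 / 4))

/-- The derivative of `hankelH0` on the positive half-line. -/
def hankelH0Deriv (z : ℝ) : ℂ := (besselJ0Deriv z : ℂ) + Complex.I * (besselY0Deriv z : ℂ)

theorem hasDerivAt_besselJ0 (z : ℝ) : HasDerivAt besselJ0 (besselJ0Deriv z) z := by
  rw [funext besselJ0_eq]
  exact factorialBound_coeffJ.hasDerivAt_comp_sq z

theorem hasDerivAt_besselJ0Deriv {z : ℝ} (hz : z ≠ 0) :
    HasDerivAt besselJ0Deriv (-(besselJ0Deriv z / z) - besselJ0 z) z := by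
  refine (factorialBound_coeffJ.hasDerivAt_deriv_comp_sq z).congr_deriv ?_
  have h := entireSum_coeffJ_recurrence (z ^ 2 / 4)
  rw [besselJ0_eq, besselJ0Deriv]
  field_simp
  linarith

theorem hasDerivAt_log_half {z : ℝ} (hz : z ≠ 0) :
    HasDerivAt (fun z => Real.log (z / 2) + Real.eulerMascheroniConstant) z⁻¹ z := by
  have h := (((hasDerivAt_id z).div_const 2).log (by simpa using hz)).add_const
    Real.eulerMascheroniConstant
  refine h.congr_deriv ?_
  simp only [id]
  field_simp

theorem hasDerivAt_besselY0 {z : ℝ} (hz : z ≠ 0) : HasDerivAt besselY0 (besselY0Deriv z) z := by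
  rw [funext besselY0_eq]
  have h := (((hasDerivAt_log_half hz).mul (factorialBound_coeffJ.hasDerivAt_comp_sq z)).add
    (factorialBound_coeffY.hasDerivAt_comp_sq z)).const_mul (2 / Real.pi)
  refine h.congr_deriv ?_
  rw [besselY0Deriv, besselJ0_eq, besselJ0Deriv]
  ring

theorem hasDerivAt_besselY0Deriv {z : ℝ} (hz : z ≠ 0) :
    HasDerivAt besselY0Deriv (-(besselY0Deriv z / z) - besselY0 z) z := by
  have h := ((((hasDerivAt_besselJ0 z).div (hasDerivAt_id z) hz).add
    ((hasDerivAt_log_half hz).mul (hasDerivAt_besselJ0Deriv hz))).add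
    (factorialBound_coeffY.hasDerivAt_deriv_comp_sq z)).const_mul (2 / Real.pi)
  refine h.congr_deriv ?_
  have hJ := entireSum_coeffY_recurrence (z ^ 2 / 4)
  have hJ' : entireSum (derivCoeff coeffJ) (z ^ 2 / 4) = 2 * besselJ0Deriv z / z := by
    rw [besselJ0Deriv]; field_simp
  rw [hJ'] at hJ
  rw [besselY0_eq, besselY0Deriv, ← besselJ0_eq]
  simp only [id]
  set A := entireSum (derivCoeff (derivCoeff coeffY)) (z ^ 2 / 4)
  set B := entireSum (derivCoeff coeffY) (z ^ 2 / 4)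
  have hJ2 : entireSum coeffY (z ^ 2 / 4) = -(2 * besselJ0Deriv z / z) - z ^ 2 / 4 * A - B := by
    linarith
  rw [hJ2]
  have := Real.pi_ne_zero
  field_simp
  ring

theorem hasDerivAt_hankelH0 {z : ℝ} (hz : z ≠ 0) : HasDerivAt hankelH0 (hankelH0Deriv z) z :=
  (hasDerivAt_besselJ0 z).ofReal_comp.add ((hasDerivAt_besselY0 hz).ofReal_comp.const_mul _)

theorem hasDerivAt_hankelH0Deriv {z : ℝ} (hz : z ≠ 0) :
    HasDerivAt hankelH0Deriv (-(hankelH0Deriv z / z) - hankelH0 z) z := by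
  have h := (hasDerivAt_besselJ0Deriv hz).ofReal_comp.add
    ((hasDerivAt_besselY0Deriv hz).ofReal_comp.const_mul Complex.I)
  refine h.congr_deriv ?_
  rw [hankelH0Deriv, hankelH0]
  push_cast
  ring

theorem contDiffOn_hankelH0 (n : ℕ) : ContDiffOn ℝ n hankelH0 (Set.Ioi 0) := by
  have hJ : ContDiff ℝ n besselJ0 := by
    rw [funext besselJ0_eq]
    exact (factorialBound_coeffJ.contDiff n).comp (by fun_prop)
  have hlog : ContDiffOn ℝ n (fun z : ℝ => Real.log (z / 2)) (Set.Ioi 0) :=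
    ContDiffOn.log (by fun_prop) fun z hz => (div_pos hz two_pos).ne'
  have hY : ContDiffOn ℝ n besselY0 (Set.Ioi 0) := by
    rw [funext besselY0_eq]
    simp_rw [← besselJ0_eq]
    exact contDiffOn_const.mul (((hlog.add contDiffOn_const).mul hJ.contDiffOn).add
      ((factorialBound_coeffY.contDiff n).comp (by fun_prop)).contDiffOn)
  exact (Complex.ofRealCLM.contDiff.comp_contDiffOn hJ.contDiffOn).add
    (contDiffOn_const.mul (Complex.ofRealCLM.contDiff.comp_contDiffOn hY))

theorem exists_bound_Icc {f : ℝ → ℝ} (hf : Continuous f) :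
    ∃ C : ℝ, 0 ≤ C ∧ ∀ z ∈ Set.Icc (0 : ℝ) 1, |f z| ≤ C := by
  obtain ⟨C, hC⟩ := isCompact_Icc.exists_bound_of_continuousOn (s := Set.Icc (0 : ℝ) 1)
    hf.continuousOn
  exact ⟨C, (abs_nonneg (f 0)).trans (hC 0 (by simp)), hC⟩

theorem log_two_le_log_two_add_inv {z : ℝ} (hz : 0 < z) : 1 / 2 ≤ Real.log (2 + z⁻¹) := by
  have h : Real.log 2 ≤ Real.log (2 + z⁻¹) :=
    Real.log_le_log two_pos (by have := inv_pos.2 hz; linarith)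
  linarith [Real.log_two_gt_d9]

theorem abs_log_half_add_le {z : ℝ} (hz : 0 < z) (γ : ℝ) :
    |Real.log (z / 2) + γ| ≤ |Real.log z| + (|γ| + Real.log 2) := by
  rw [Real.log_div hz.ne' two_ne_zero]
  have := Real.log_pos one_lt_two
  calc _ = |Real.log z + (γ + -Real.log 2)| := by ring_nf
    _ ≤ |Real.log z| + (|γ| + |-Real.log 2|) :=
      (abs_add_le _ _).trans (by gcongr; exact abs_add_le _ _)
    _ = _ := by rw [abs_neg, abs_of_pos this]

/-- Near the origin `H₀⁽¹⁾` has a logarithmic singularity. -/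
theorem exists_norm_hankelH0_le_abs_log :
    ∃ C : ℝ, 0 ≤ C ∧ ∀ z, 0 < z → z ≤ 1 → ‖hankelH0 z‖ ≤ C * (1 + |Real.log z|) := by
  have hJc : Continuous besselJ0 :=
    continuous_iff_continuousAt.2 fun z => (hasDerivAt_besselJ0 z).continuousAt
  obtain ⟨A, hA0, hA⟩ := exists_bound_Icc hJc
  obtain ⟨B, hB0, hB⟩ := exists_bound_Icc
    (factorialBound_coeffY.continuous.comp (by fun_prop : Continuous fun z : ℝ => z ^ 2 / 4))
  set c : ℝ := |Real.eulerMascheroniConstant| + Real.log 2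
  have hc : 0 ≤ c := by have := Real.log_pos one_lt_two; positivity
  refine ⟨A + (2 / Real.pi) * ((1 + c) * A + B), by positivity, fun z hz hz1 => ?_⟩
  have hzI : z ∈ Set.Icc (0 : ℝ) 1 := ⟨hz.le, hz1⟩
  have h1 : ‖hankelH0 z‖ ≤ |besselJ0 z| + |besselY0 z| := by
    refine (norm_add_le _ _).trans ?_
    simp
  have h2 : |Real.log (z / 2) + Real.eulerMascheroniConstant| ≤ |Real.log z| + c :=
    abs_log_half_add_le hz _
  have h3 : |besselY0 z| ≤ (2 / Real.pi) * ((|Real.log z| + c) * A + B) := by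
    rw [besselY0_eq, ← besselJ0_eq, abs_mul, abs_of_pos (by positivity : 0 < 2 / Real.pi)]
    gcongr
    refine (abs_add_le _ _).trans (add_le_add ?_ (hB z hzI))
    rw [abs_mul]
    exact mul_le_mul h2 (hA z hzI) (abs_nonneg _) (by positivity)
  have h4 := hA z hzI
  have h5 : (|Real.log z| + c) * A + B ≤ ((1 + c) * A + B) * (1 + |Real.log z|) := by
    nlinarith [abs_nonneg (Real.log z), mul_nonneg hc hA0,
      mul_nonneg (mul_nonneg hc hA0) (abs_nonneg (Real.log z)),
      mul_nonneg hB0 (abs_nonneg (Real.log z)), mul_nonneg hA0 (abs_nonneg (Real.log z))]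
  have h6 : (2 / Real.pi) * ((|Real.log z| + c) * A + B) ≤
      (2 / Real.pi) * (((1 + c) * A + B) * (1 + |Real.log z|)) := by gcongr
  nlinarith [mul_nonneg hA0 (abs_nonneg (Real.log z))]

theorem exists_norm_hankelH0_le_rpow :
    ∃ C : ℝ, 0 ≤ C ∧ ∀ z, 0 < z → ‖hankelH0 z‖ ≤ C * z ^ (-(1 / 2) : ℝ) := by
  obtain ⟨A, hA0, hA⟩ := exists_norm_hankelH0_le_abs_log
  obtain ⟨B, hB0, hB⟩ := exists_bessel_decay (y := hankelH0) (y' := hankelH0Deriv)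
    (fun z hz => hasDerivAt_hankelH0 hz.ne') (fun z hz => hasDerivAt_hankelH0Deriv hz.ne')
  refine ⟨3 * A + B, by positivity, fun z hz => ?_⟩
  have hp : 0 < z ^ (-(1 / 2) : ℝ) := Real.rpow_pos_of_pos hz _
  rcases le_total z 1 with h | h
  · refine (hA z hz h).trans ?_
    have h1 := one_le_rpow_neg_half hz h
    have h2 : |Real.log z| ≤ 2 * z ^ (-(1 / 2) : ℝ) := by
      have h3 := Real.abs_log_mul_self_rpow_lt z (1 / 2) hz h (by norm_num)
      rw [abs_mul, abs_of_pos (Real.rpow_pos_of_pos hz _)] at h3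
      rw [Real.rpow_neg hz.le, ← div_eq_mul_inv, le_div_iff₀ (Real.rpow_pos_of_pos hz _)]
      norm_num at h3 ⊢
      exact h3.le
    nlinarith
  · refine (hB z h).1.trans ?_
    nlinarith

theorem exists_norm_hankelH0_le_log :
    ∃ C : ℝ, 0 ≤ C ∧ ∀ z, 0 < z → ‖hankelH0 z‖ ≤ C * Real.log (2 + z⁻¹) := by
  obtain ⟨A, hA0, hA⟩ := exists_norm_hankelH0_le_abs_log
  obtain ⟨B, hB0, hB⟩ := exists_norm_hankelH0_le_rpow
  refine ⟨3 * A + 2 * B, by positivity, fun z hz => ?_⟩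
  have hl := log_two_le_log_two_add_inv hz
  rcases le_total z 1 with h | h
  · refine (hA z hz h).trans ?_
    have h2 : |Real.log z| ≤ Real.log (2 + z⁻¹) := by
      rw [abs_of_nonpos (Real.log_nonpos hz.le h), ← Real.log_inv]
      exact Real.log_le_log (inv_pos.2 hz) (by linarith)
    nlinarith
  · refine (hB z hz).trans ?_
    have h2 : z ^ (-(1 / 2) : ℝ) ≤ 1 := Real.rpow_le_one_of_one_le_of_nonpos h (by norm_num)
    nlinarith

/-- Up to a locally integrable error, the derivative of `H₀⁽¹⁾` is that of its logarithmic
singularity. -/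
theorem exists_norm_hankelH0Deriv_sub_le :
    ∃ (c : ℂ) (C : ℝ), 0 ≤ C ∧
      ∀ z, 0 < z → ‖hankelH0Deriv z - c / z‖ ≤ C * z ^ (-(1 / 2) : ℝ) := by
  obtain ⟨F, hF0, hF⟩ := exists_bound_Icc (factorialBound_coeffJ.derivCoeff.continuous.comp
    (by fun_prop : Continuous fun z : ℝ => z ^ 2 / 4))
  obtain ⟨G, hG0, hG⟩ := exists_bound_Icc (factorialBound_coeffY.derivCoeff.continuous.comp
    (by fun_prop : Continuous fun z : ℝ => z ^ 2 / 4))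
  obtain ⟨B, hB0, hB⟩ := exists_bessel_decay (y := hankelH0) (y' := hankelH0Deriv)
    (fun z hz => hasDerivAt_hankelH0 hz.ne') (fun z hz => hasDerivAt_hankelH0Deriv hz.ne')
  have hJ' : ∀ z ∈ Set.Icc (0 : ℝ) 1, |besselJ0Deriv z| ≤ z * F := by
    intro z hz
    rw [besselJ0Deriv, abs_mul, abs_of_nonneg (by linarith [hz.1] : 0 ≤ z / 2)]
    have := hF z hz
    simp only [Function.comp] at this
    nlinarith [hz.1, abs_nonneg (entireSum (derivCoeff coeffJ) (z ^ 2 / 4)), mul_nonneg hz.1 hF0]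
  have hJ : ∀ z ∈ Set.Icc (0 : ℝ) 1, |besselJ0 z - 1| ≤ F * z := by
    intro z hz
    have h0 : besselJ0 0 = 1 := by
      rw [besselJ0_eq, entireSum, tsum_eq_single 0]
      · simp [coeffJ]
      · intro m hm; simp [hm]
    have := (convex_Icc (0 : ℝ) 1).norm_image_sub_le_of_norm_hasDerivWithin_le (C := F)
      (fun x _ => (hasDerivAt_besselJ0 x).hasDerivWithinAt)
      (fun x hx => (hJ' x hx).trans (by nlinarith [hx.2]))
      (Set.left_mem_Icc.2 zero_le_one) hz
    rw [h0] at this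
    simpa [abs_of_nonneg hz.1] using this
  set c : ℝ := |Real.eulerMascheroniConstant| + Real.log 2
  have hc : 0 ≤ c := by have := Real.log_pos one_lt_two; positivity
  refine ⟨Complex.I * (2 / Real.pi : ℝ), F + 2 / Real.pi * (F + (1 + c) * F + G) +
    (B + 2 / Real.pi), by positivity, fun z hz => ?_⟩
  have hp : 0 < z ^ (-(1 / 2) : ℝ) := Real.rpow_pos_of_pos hz _
  have hnn : 0 ≤ F + 2 / Real.pi * (F + (1 + c) * F + G) := by positivity
  have hnn' : 0 ≤ B + 2 / Real.pi := by positivity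
  rcases le_total z 1 with h | h
  · have hzI : z ∈ Set.Icc (0 : ℝ) 1 := ⟨hz.le, h⟩
    have e1 : hankelH0Deriv z - Complex.I * (2 / Real.pi : ℝ) / z =
        (besselJ0Deriv z : ℂ) + Complex.I * ((2 / Real.pi * ((besselJ0 z - 1) / z +
          (Real.log (z / 2) + Real.eulerMascheroniConstant) * besselJ0Deriv z +
          z / 2 * entireSum (derivCoeff coeffY) (z ^ 2 / 4)) : ℝ) : ℂ) := by
      rw [hankelH0Deriv, besselY0Deriv]
      push_cast
      ring
    have h2 : |Real.log (z / 2) + Real.eulerMascheroniConstant| ≤ |Real.log z| + c :=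
      abs_log_half_add_le hz _
    have h3 : |Real.log z| * z ≤ 1 := by
      have := Real.abs_log_mul_self_lt z hz h
      rw [abs_mul, abs_of_pos hz] at this
      exact this.le
    have h4 : |(besselJ0 z - 1) / z| ≤ F := by
      rw [abs_div, abs_of_pos hz, div_le_iff₀ hz]
      exact hJ z hzI
    have h5 : |(Real.log (z / 2) + Real.eulerMascheroniConstant) * besselJ0Deriv z| ≤
        (1 + c) * F := by
      rw [abs_mul]
      calc _ ≤ (|Real.log z| + c) * (z * F) :=
            mul_le_mul h2 (hJ' z hzI) (abs_nonneg _) (by positivity)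
        _ = (|Real.log z| * z + c * z) * F := by ring
        _ ≤ (1 + c) * F := by
          gcongr
          nlinarith
    have h6 : |z / 2 * entireSum (derivCoeff coeffY) (z ^ 2 / 4)| ≤ G := by
      have := hG z hzI
      simp only [Function.comp] at this
      rw [abs_mul, abs_of_pos (by linarith : 0 < z / 2)]
      nlinarith [abs_nonneg (entireSum (derivCoeff coeffY) (z ^ 2 / 4))]
    rw [e1]
    have h7 : ‖(besselJ0Deriv z : ℂ) + Complex.I * ((2 / Real.pi * ((besselJ0 z - 1) / z +
          (Real.log (z / 2) + Real.eulerMascheroniConstant) * besselJ0Deriv z +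
          z / 2 * entireSum (derivCoeff coeffY) (z ^ 2 / 4)) : ℝ) : ℂ)‖ ≤
        F + 2 / Real.pi * (F + (1 + c) * F + G) := by
      refine (norm_add_le _ _).trans (add_le_add ?_ ?_)
      · rw [Complex.norm_real, Real.norm_eq_abs]
        exact (hJ' z hzI).trans (by nlinarith)
      · rw [norm_mul, Complex.norm_I, one_mul, Complex.norm_real, Real.norm_eq_abs, abs_mul,
          abs_of_pos (by positivity : 0 < 2 / Real.pi)]
        gcongr
        exact (abs_add_le _ _).trans (add_le_add ((abs_add_le _ _).trans (add_le_add h4 h5)) h6)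
    refine h7.trans ?_
    nlinarith [one_le_rpow_neg_half hz h]
  · have h1 : ‖Complex.I * (2 / Real.pi : ℝ) / (z : ℂ)‖ ≤ 2 / Real.pi * z ^ (-(1 / 2) : ℝ) := by
      rw [norm_div, norm_mul, Complex.norm_I, one_mul, Complex.norm_real, Complex.norm_real,
        Real.norm_eq_abs, Real.norm_eq_abs, abs_of_pos (by positivity : 0 < 2 / Real.pi),
        abs_of_pos hz, div_eq_mul_inv, ← Real.rpow_neg_one]
      gcongr
      norm_num
    refine (norm_sub_le _ _).trans ?_
    nlinarith [(hB z h).2]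

/-! ### Angular integrals of plane waves -/

/-- The weighted angular integral `∫ p(θ) exp(-i z cos θ) dθ` over the circle. For `p = 1` this is
`2π J₀(z)`. -/
def angularIntegral (p : ℝ → ℂ) (z : ℝ) : ℂ :=
  ∫ θ in -Real.pi..Real.pi, p θ * Complex.exp (-(Complex.I * (z * Real.cos θ : ℝ)))

theorem norm_exp_neg_I_mul_ofReal (x : ℝ) : ‖Complex.exp (-(Complex.I * x))‖ = 1 := by
  rw [Complex.norm_exp]; simp

theorem norm_angularIntegral_le {p : ℝ → ℂ} (hp : ∀ θ, ‖p θ‖ ≤ 1) (z : ℝ) :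
    ‖angularIntegral p z‖ ≤ 2 * Real.pi := by
  have h := intervalIntegral.norm_integral_le_of_norm_le_const (a := -Real.pi) (b := Real.pi)
    (C := 1) (f := fun θ => p θ * Complex.exp (-(Complex.I * (z * Real.cos θ : ℝ))))
    (fun θ _ => by rw [norm_mul, norm_exp_neg_I_mul_ofReal, mul_one]; exact hp θ)
  refine h.trans (le_of_eq ?_)
  rw [abs_of_pos (by linarith [Real.pi_pos])]
  ring

theorem hasDerivAt_angularIntegral {p : ℝ → ℂ} (hp : Continuous p) (hp1 : ∀ θ, ‖p θ‖ ≤ 1) (z : ℝ) :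
    HasDerivAt (angularIntegral p)
      (angularIntegral (fun θ => p θ * -(Complex.I * Real.cos θ)) z) z := by
  have h := intervalIntegral.hasDerivAt_integral_of_dominated_loc_of_deriv_le (𝕜 := ℝ)
    (μ := volume) (a := -Real.pi) (b := Real.pi) (bound := fun _ => 1) (x₀ := z) (s := Set.univ)
    (F := fun z θ => p θ * Complex.exp (-(Complex.I * (z * Real.cos θ : ℝ))))
    (F' := fun z θ => p θ * -(Complex.I * Real.cos θ) *
      Complex.exp (-(Complex.I * (z * Real.cos θ : ℝ))))
    univ_mem (Eventually.of_forall fun z => (by fun_prop : Continuous _).aestronglyMeasurable)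
    ((by fun_prop : Continuous _).intervalIntegrable _ _)
    ((by fun_prop : Continuous _).aestronglyMeasurable) ?_ (by simp) ?_
  · exact h.2
  · refine Eventually.of_forall fun θ _ z _ => ?_
    rw [norm_mul, norm_exp_neg_I_mul_ofReal, mul_one, norm_mul, norm_neg, norm_mul, Complex.norm_I,
      one_mul, Complex.norm_real, Real.norm_eq_abs]
    exact mul_le_one₀ (hp1 θ) (abs_nonneg _) (Real.abs_cos_le_one θ)
  · refine Eventually.of_forall fun θ _ z _ => ?_
    have h1 : HasDerivAt (fun z : ℝ => -(Complex.I * (z * Real.cos θ : ℝ)))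
        (-(Complex.I * Real.cos θ)) z := by
      have h2 := (((hasDerivAt_id z).mul_const (Real.cos θ)).ofReal_comp.const_mul Complex.I).neg
      refine h2.congr_deriv ?_
      simp
    refine (h1.cexp.const_mul (p θ)).congr_deriv ?_
    ring

/-- The angular average of a plane wave, which equals `2π J₀`. -/
def waveAverage : ℝ → ℂ := angularIntegral fun _ => 1

/-- The derivative of `waveAverage`. -/
def waveAverageDeriv : ℝ → ℂ := angularIntegral fun θ => -(Complex.I * Real.cos θ)

theorem norm_neg_I_mul_cos_le (θ : ℝ) : ‖-(Complex.I * Real.cos θ)‖ ≤ 1 := by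
  rw [norm_neg, norm_mul, Complex.norm_I, one_mul, Complex.norm_real]
  exact Real.abs_cos_le_one θ

theorem hasDerivAt_waveAverage (z : ℝ) : HasDerivAt waveAverage (waveAverageDeriv z) z := by
  refine (hasDerivAt_angularIntegral continuous_const (by simp) z).congr_deriv ?_
  simp [waveAverageDeriv]

theorem continuous_waveAverage : Continuous waveAverage :=
  continuous_iff_continuousAt.2 fun z => (hasDerivAt_waveAverage z).continuousAt

theorem hasDerivAt_waveAverageDeriv' (z : ℝ) : HasDerivAt waveAverageDeriv
    (angularIntegral (fun θ => -(Complex.I * Real.cos θ) * -(Complex.I * Real.cos θ)) z) z :=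
  hasDerivAt_angularIntegral (by fun_prop) norm_neg_I_mul_cos_le z

theorem continuous_waveAverageDeriv : Continuous waveAverageDeriv :=
  continuous_iff_continuousAt.2 fun z => (hasDerivAt_waveAverageDeriv' z).continuousAt

/-- The angular average of a plane wave solves Bessel's equation of order zero. -/
theorem hasDerivAt_waveAverageDeriv {z : ℝ} (hz : z ≠ 0) :
    HasDerivAt waveAverageDeriv (-(waveAverageDeriv z / z) - waveAverage z) z := by
  refine (hasDerivAt_waveAverageDeriv' z).congr_deriv ?_
  -- the integrand of `z J'' + J' + z J` is an exact derivative in the angle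
  have hd : ∀ θ : ℝ, HasDerivAt
      (fun θ : ℝ => -Complex.I * Real.sin θ * Complex.exp (-(Complex.I * (z * Real.cos θ : ℝ))))
      ((-Complex.I * Real.cos θ + z * Real.sin θ ^ 2) *
        Complex.exp (-(Complex.I * (z * Real.cos θ : ℝ)))) θ := by
    intro θ
    have h1 := (Real.hasDerivAt_sin θ).ofReal_comp.const_mul (-Complex.I)
    have h2 := (((Real.hasDerivAt_cos θ).const_mul z).ofReal_comp.const_mul Complex.I).neg.cexp
    refine (h1.mul h2).congr_deriv ?_
    push_cast
    linear_combination (-(z : ℂ) * Complex.sin θ ^ 2 *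
      Complex.exp (-(Complex.I * (z * Complex.cos θ)))) * Complex.I_sq
  have h0 := intervalIntegral.integral_eq_sub_of_hasDerivAt (a := -Real.pi) (b := Real.pi)
    (fun θ _ => hd θ) ((by fun_prop : Continuous _).intervalIntegrable _ _)
  simp only [Real.sin_pi, Real.sin_neg, neg_zero, Complex.ofReal_zero, mul_zero, zero_mul,
    sub_self] at h0
  have hz' : (z : ℂ) ≠ 0 := by exact_mod_cast hz
  have h1 : (z : ℂ) * angularIntegral
      (fun θ => -(Complex.I * Real.cos θ) * -(Complex.I * Real.cos θ)) z + waveAverageDeriv z +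
      z * waveAverage z = 0 := by
    rw [← h0, waveAverageDeriv, waveAverage, angularIntegral, angularIntegral, angularIntegral,
      ← intervalIntegral.integral_const_mul, ← intervalIntegral.integral_const_mul,
      ← intervalIntegral.integral_add, ← intervalIntegral.integral_add]
    · refine intervalIntegral.integral_congr fun θ _ => ?_
      have hs : (Real.sin θ : ℂ) ^ 2 = 1 - (Real.cos θ : ℂ) ^ 2 := by
        exact_mod_cast Real.sin_sq θ
      simp only [hs]
      linear_combination ((z : ℂ) * Real.cos θ ^ 2 *
        Complex.exp (-(Complex.I * (z * Real.cos θ : ℝ)))) * Complex.I_sq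
    all_goals exact (by fun_prop : Continuous _).intervalIntegrable _ _
  generalize angularIntegral
    (fun θ => -(Complex.I * Real.cos θ) * -(Complex.I * Real.cos θ)) z = S at h1 ⊢
  field_simp
  linear_combination h1

theorem norm_waveAverage_le (z : ℝ) : ‖waveAverage z‖ ≤ 2 * Real.pi :=
  norm_angularIntegral_le (by simp) z

theorem norm_waveAverageDeriv_le (z : ℝ) : ‖waveAverageDeriv z‖ ≤ 2 * Real.pi :=
  norm_angularIntegral_le norm_neg_I_mul_cos_le z

theorem norm_waveAverageDeriv_le_mul (z : ℝ) : ‖waveAverageDeriv z‖ ≤ 2 * Real.pi * |z| := by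
  have h0 : waveAverageDeriv 0 = 0 := by
    rw [waveAverageDeriv, angularIntegral]
    simp only [zero_mul, Complex.ofReal_zero, mul_zero, neg_zero, Complex.exp_zero, mul_one]
    rw [intervalIntegral.integral_neg, intervalIntegral.integral_const_mul,
      intervalIntegral.integral_ofReal, integral_cos]
    simp
  have := convex_univ.norm_image_sub_le_of_norm_hasDerivWithin_le (C := 2 * Real.pi)
    (fun x _ => (hasDerivAt_waveAverageDeriv' x).hasDerivWithinAt)
    (fun x _ => norm_angularIntegral_le (fun θ => by
      rw [norm_mul]
      exact mul_le_one₀ (norm_neg_I_mul_cos_le θ) (norm_nonneg _) (norm_neg_I_mul_cos_le θ)) x)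
    (Set.mem_univ 0) (Set.mem_univ z)
  rw [h0] at this
  simpa using this

theorem exists_norm_waveAverageDeriv_le_rpow :
    ∃ C : ℝ, 0 ≤ C ∧ ∀ z, 0 < z → ‖waveAverageDeriv z‖ ≤ C * z ^ (-(1 / 2) : ℝ) := by
  obtain ⟨B, hB0, hB⟩ := exists_bessel_decay (y := waveAverage) (y' := waveAverageDeriv)
    (fun z _ => hasDerivAt_waveAverage z) (fun z hz => hasDerivAt_waveAverageDeriv hz.ne')
  refine ⟨B + 2 * Real.pi, by positivity, fun z hz => ?_⟩
  have hp : 0 < z ^ (-(1 / 2) : ℝ) := Real.rpow_pos_of_pos hz _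
  rcases le_total z 1 with h | h
  · refine (norm_waveAverageDeriv_le z).trans ?_
    nlinarith [one_le_rpow_neg_half hz h, Real.pi_pos]
  · refine (hB z h).2.trans ?_
    nlinarith [Real.pi_pos]

/-- The angular average of a plane wave has a primitive `K` which decays like `z ^ (-1/2)`, namely
`K(z) = -J'(z) + ∫_z^∞ J'(u) / u du` with `J = waveAverage`, by Bessel's equation. -/
theorem exists_primitive_waveAverage :
    ∃ (K : ℝ → ℂ) (C : ℝ), 0 ≤ C ∧ Continuous K ∧ (∀ z > 0, HasDerivAt K (waveAverage z) z) ∧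
      (∀ z ≥ 0, ‖K z‖ ≤ C) ∧ ∀ z > 0, ‖K z‖ ≤ C * z ^ (-(1 / 2) : ℝ) := by
  obtain ⟨B, hB0, hB⟩ := exists_norm_waveAverageDeriv_le_rpow
  set G : ℝ → ℂ := fun u => waveAverageDeriv u / u with hG
  have hGc : ∀ u : ℝ, u ≠ 0 → ContinuousAt G u := fun u hu =>
    (continuous_waveAverageDeriv.continuousAt).div
      Complex.continuous_ofReal.continuousAt (by exact_mod_cast hu)
  have hGm : ∀ s : Set ℝ, MeasurableSet s → s ⊆ Set.Ioi 0 →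
      AEStronglyMeasurable G (volume.restrict s) := fun s hs h0 =>
    ContinuousOn.aestronglyMeasurable
      (fun u hu => (hGc u (ne_of_gt (h0 hu))).continuousWithinAt) hs
  have hG1 : ∀ u, ‖G u‖ ≤ 2 * Real.pi := by
    intro u
    rw [hG]
    simp only
    rw [norm_div, Complex.norm_real, Real.norm_eq_abs]
    exact div_le_of_le_mul₀ (abs_nonneg _) (by positivity) (norm_waveAverageDeriv_le_mul u)
  have hG2 : ∀ u > 0, ‖G u‖ ≤ B * u ^ (-(3 / 2) : ℝ) := by
    intro u hu
    rw [hG]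
    simp only
    rw [norm_div, Complex.norm_real, Real.norm_eq_abs, abs_of_pos hu, div_le_iff₀ hu, mul_assoc]
    nth_rewrite 3 [← Real.rpow_one u]
    rw [← Real.rpow_add hu]
    norm_num
    simpa [neg_div] using hB u hu
  have hIoi : ∀ z > 0, IntegrableOn G (Set.Ioi z) := by
    intro z hz
    refine Integrable.mono' ((integrableOn_Ioi_rpow_of_lt (by norm_num : (-(3 / 2) : ℝ) < -1)
      hz).const_mul B) (hGm _ measurableSet_Ioi fun u hu => hz.trans hu) ?_
    refine (ae_restrict_iff' measurableSet_Ioi).2 (Eventually.of_forall fun u hu => ?_)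
    exact hG2 u (hz.trans hu)
  have hI : IntegrableOn G (Set.Ioi 0) := by
    rw [← Set.Ioc_union_Ioi_eq_Ioi (zero_le_one : (0 : ℝ) ≤ 1)]
    refine IntegrableOn.union ?_ (hIoi 1 one_pos)
    refine Integrable.mono' (integrableOn_const (C := 2 * Real.pi) (by simp))
      (hGm _ measurableSet_Ioc fun u hu => hu.1) ?_
    refine (ae_restrict_iff' measurableSet_Ioc).2 (Eventually.of_forall fun u hu => ?_)
    exact hG1 u
  have hsplit : ∀ z ≥ 0, (∫ u in Set.Ioi 0, G u) - ∫ u in (0 : ℝ)..z, G u =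
      ∫ u in Set.Ioi z, G u := by
    intro z hz
    rw [intervalIntegral.integral_of_le hz, ← Set.Ioc_union_Ioi_eq_Ioi hz,
      setIntegral_union (Set.Ioc_disjoint_Ioi le_rfl) measurableSet_Ioi
        (hI.mono_set fun u hu => hu.1) (hI.mono_set fun u hu => lt_of_le_of_lt hz hu)]
    ring
  set A : ℝ := ∫ u in Set.Ioi 0, ‖G u‖
  have hA0 : 0 ≤ A := integral_nonneg fun u => norm_nonneg _
  have hII : ∀ a b : ℝ, IntervalIntegrable G volume a b := by
    intro a b
    have hm : AEStronglyMeasurable G volume :=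
      (continuous_waveAverageDeriv.measurable.div
        Complex.continuous_ofReal.measurable).aestronglyMeasurable
    exact (intervalIntegrable_const (c := 2 * Real.pi)).mono_fun' hm.restrict
      (Eventually.of_forall hG1)
  refine ⟨fun z => -waveAverageDeriv z + ((∫ u in Set.Ioi 0, G u) - ∫ u in (0 : ℝ)..z, G u),
    2 * Real.pi + A + B + 2 * B, by positivity, ?_, ?_, ?_, ?_⟩
  · exact continuous_waveAverageDeriv.neg.add
      (continuous_const.sub (intervalIntegral.continuous_primitive hII 0))
  · intro z hz
    have h1 := intervalIntegral.integral_hasDerivAt_right (hII 0 z)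
      ⟨Set.Ioi 0, Ioi_mem_nhds hz, hGm _ measurableSet_Ioi le_rfl⟩ (hGc z hz.ne')
    refine ((hasDerivAt_waveAverageDeriv hz.ne').neg.add (h1.const_sub _)).congr_deriv ?_
    simp only [hG]
    ring
  · intro z hz
    simp only [hsplit z hz]
    have h1 : ‖∫ u in Set.Ioi z, G u‖ ≤ A := (norm_integral_le_integral_norm _).trans
      (setIntegral_mono_set hI.norm (Eventually.of_forall fun u => norm_nonneg _)
        (Set.Ioi_subset_Ioi hz).eventuallyLE)
    refine (norm_add_le _ _).trans ?_
    rw [norm_neg]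
    linarith [norm_waveAverageDeriv_le z]
  · intro z hz
    simp only [hsplit z hz.le]
    have hp : 0 < z ^ (-(1 / 2) : ℝ) := Real.rpow_pos_of_pos hz _
    have h1 : ‖∫ u in Set.Ioi z, G u‖ ≤ 2 * B * z ^ (-(1 / 2) : ℝ) := by
      have h2 : ‖∫ u in Set.Ioi z, G u‖ ≤ ∫ u in Set.Ioi z, B * u ^ (-(3 / 2) : ℝ) := by
        refine norm_integral_le_of_norm_le ((integrableOn_Ioi_rpow_of_lt
          (by norm_num : (-(3 / 2) : ℝ) < -1) hz).const_mul B) ?_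
        refine (ae_restrict_iff' measurableSet_Ioi).2 (Eventually.of_forall fun u hu => ?_)
        exact hG2 u (hz.trans hu)
      refine h2.trans (le_of_eq ?_)
      rw [integral_const_mul, integral_Ioi_rpow_of_lt (by norm_num) hz]
      norm_num
      ring
    refine (norm_add_le _ _).trans ?_
    rw [norm_neg]
    nlinarith [hB z hz, mul_nonneg hA0 hp.le, mul_nonneg Real.pi_pos.le hp.le]

/-! ### The radial cut-off function -/

/-- A smooth function on `ℝ` which is one on `[-2, 2]` and vanishes off `(-3, 3)`. -/
def cutoff : ContDiffBump (0 : ℝ) := ⟨2, 3, by norm_num, by norm_num⟩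

/-- The cut-off function `r ↦ cutoff (r²)`, which is one for `r² ≤ 2` and vanishes for `r² ≥ 3`. The
square makes its composition with the Euclidean norm smooth. -/
def radialCutoff (r : ℝ) : ℝ := cutoff (r ^ 2)

theorem cutoff_eq_one {u : ℝ} (hu : |u| ≤ 2) : cutoff u = 1 :=
  cutoff.one_of_mem_closedBall (by simpa [cutoff] using hu)

theorem cutoff_eq_zero {u : ℝ} (hu : 3 ≤ |u|) : cutoff u = 0 :=
  cutoff.zero_of_le_dist (by simpa [cutoff] using hu)

theorem contDiff_radialCutoff : ContDiff ℝ 1 radialCutoff :=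
  cutoff.contDiff.comp (contDiff_id.pow 2)

theorem hasDerivAt_radialCutoff (r : ℝ) : HasDerivAt radialCutoff (deriv radialCutoff r) r :=
  (contDiff_radialCutoff.differentiable one_ne_zero r).hasDerivAt

theorem continuous_radialCutoff : Continuous radialCutoff := contDiff_radialCutoff.continuous

theorem continuous_deriv_radialCutoff : Continuous (deriv radialCutoff) :=
  contDiff_radialCutoff.continuous_deriv_one

theorem abs_radialCutoff_le (r : ℝ) : |radialCutoff r| ≤ 1 := by
  rw [radialCutoff, abs_of_nonneg cutoff.nonneg]
  exact cutoff.le_one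

theorem radialCutoff_eq_zero {r : ℝ} (hr : 2 ≤ r) : radialCutoff r = 0 :=
  cutoff_eq_zero (by rw [abs_of_nonneg (sq_nonneg r)]; nlinarith)

theorem radialCutoff_zero : radialCutoff 0 = 1 := cutoff_eq_one (by simp)

theorem deriv_radialCutoff_eq_zero {r : ℝ} (h0 : 0 ≤ r) (hr : r ≤ 1) :
    deriv radialCutoff r = 0 := by
  have h : radialCutoff =ᶠ[𝓝 r] fun _ => 1 := by
    have h2 : ∀ᶠ x : ℝ in 𝓝 r, |x ^ 2| < 2 :=
      (by fun_prop : Continuous fun x : ℝ => |x ^ 2|).continuousAt.eventually_lt_const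
        (by simp only [abs_of_nonneg (sq_nonneg r)]; nlinarith)
    filter_upwards [h2] with x hx
    exact cutoff_eq_one hx.le
  rw [h.deriv_eq, deriv_const]

theorem exists_abs_deriv_radialCutoff_le :
    ∃ A : ℝ, 0 ≤ A ∧ ∀ r ∈ Set.Icc (0 : ℝ) 2, |deriv radialCutoff r| ≤ A := by
  obtain ⟨C, hC⟩ := isCompact_Icc.exists_bound_of_continuousOn (s := Set.Icc (0 : ℝ) 2)
    continuous_deriv_radialCutoff.continuousOn
  exact ⟨C, (abs_nonneg _).trans (hC 0 (by simp)), hC⟩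

/-! ### One-dimensional oscillatory integrals -/

theorem intervalIntegrable_rpow_neg_half (a b : ℝ) :
    IntervalIntegrable (fun r : ℝ => r ^ (-(1 / 2) : ℝ)) volume a b :=
  intervalIntegral.intervalIntegrable_rpow' (by norm_num)

theorem integral_rpow_neg_half_le : ∫ r in (0 : ℝ)..2, r ^ (-(1 / 2) : ℝ) ≤ 4 := by
  rw [integral_rpow (Or.inl (by norm_num))]
  norm_num
  rw [← Real.sqrt_eq_rpow]
  have : √2 ≤ 2 := Real.sqrt_le_iff.2 (by norm_num)
  linarith

/-- A function on `[0, 2]` which is bounded by `A + B r ^ (-1/2)` has integral at most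
`2 A + 4 B`. -/
theorem norm_integral_le_of_norm_le_rpow {f : ℝ → ℂ} {A B : ℝ} (hB : 0 ≤ B)
    (hf : ∀ r, 0 < r → r ≤ 2 → ‖f r‖ ≤ A + B * r ^ (-(1 / 2) : ℝ)) :
    ‖∫ r in (0 : ℝ)..2, f r‖ ≤ 2 * A + 4 * B := by
  have hi := ((intervalIntegrable_rpow_neg_half 0 2).const_mul B)
  refine (intervalIntegral.norm_integral_le_of_norm_le (by norm_num)
    (Eventually.of_forall fun r hr => hf r hr.1 hr.2)
    (intervalIntegrable_const.add hi)).trans ?_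
  rw [intervalIntegral.integral_add intervalIntegrable_const hi,
    intervalIntegral.integral_const_mul, intervalIntegral.integral_const]
  simp only [smul_eq_mul]
  nlinarith [integral_rpow_neg_half_le]

theorem mul_rpow_neg_half_le {a κ r : ℝ} (ha : 0 < a) (hκ : 0 ≤ κ) (hκa : κ ≤ a) (hr : 0 < r) :
    κ * (a * r) ^ (-(1 / 2) : ℝ) ≤ √κ * r ^ (-(1 / 2) : ℝ) := by
  rw [Real.mul_rpow ha.le hr.le, ← mul_assoc]
  gcongr
  rw [Real.rpow_neg ha.le, ← Real.sqrt_eq_rpow, ← div_eq_mul_inv, div_le_iff₀ (Real.sqrt_pos.2 ha)]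
  calc κ = √κ * √κ := (Real.mul_self_sqrt hκ).symm
    _ ≤ √κ * √a := by gcongr

theorem norm_exp_I_mul_ofReal (x : ℝ) : ‖Complex.exp (Complex.I * x)‖ = 1 := by
  rw [Complex.norm_exp]; simp

theorem hasDerivAt_cutoff_mul_exp (κ r : ℝ) :
    HasDerivAt (fun r : ℝ => (radialCutoff r : ℂ) * Complex.exp (Complex.I * (κ * r : ℝ)))
      (((deriv radialCutoff r : ℝ) : ℂ) * Complex.exp (Complex.I * (κ * r : ℝ)) +
        Complex.I * κ * ((radialCutoff r : ℂ) * Complex.exp (Complex.I * (κ * r : ℝ)))) r := by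
  have h1 := (((hasDerivAt_id r).const_mul κ).ofReal_comp.const_mul Complex.I).cexp
  refine ((hasDerivAt_radialCutoff r).ofReal_comp.mul h1).congr_deriv ?_
  simp only [id]
  push_cast
  ring

theorem hasDerivAt_comp_const_mul {f : ℝ → ℂ} {f' : ℂ} {a r : ℝ} (h : HasDerivAt f f' (a * r)) :
    HasDerivAt (fun r => f (a * r)) (a * f') r := by
  have := h.scomp r ((hasDerivAt_id r).const_mul a)
  refine this.congr_deriv ?_
  simp

/-- The Fourier transform of the truncated kernel `e^{iκr} / r` in the plane, below the
wavenumber: one integrates `e^{iκr}` by parts. -/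
theorem exists_bound_waveAverage_low : ∃ C : ℝ, 0 ≤ C ∧ ∀ κ a : ℝ, 0 < κ → 0 ≤ a → a ≤ κ →
    ‖∫ r in (0 : ℝ)..2, (radialCutoff r : ℂ) * Complex.exp (Complex.I * (κ * r : ℝ)) *
      waveAverage (a * r)‖ * κ ≤ C * (1 + √κ) := by
  obtain ⟨A, hA0, hA⟩ := exists_abs_deriv_radialCutoff_le
  obtain ⟨B, hB0, hB⟩ := exists_norm_waveAverageDeriv_le_rpow
  refine ⟨2 * Real.pi + 4 * Real.pi * A + 4 * B, by have := Real.pi_pos; positivity,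
    fun κ a hκ ha haκ => ?_⟩
  have hc := continuous_waveAverage
  have hc' := continuous_waveAverageDeriv
  have hX := continuous_radialCutoff
  have hX' := continuous_deriv_radialCutoff
  set e : ℝ → ℂ := fun r => Complex.exp (Complex.I * (κ * r : ℝ)) with he
  have hec : Continuous e := by fun_prop
  set f₁ : ℝ → ℂ := fun r => ((deriv radialCutoff r : ℝ) : ℂ) * e r * waveAverage (a * r)
  set f₂ : ℝ → ℂ := fun r => (radialCutoff r : ℂ) * e r * waveAverage (a * r)
  set f₃ : ℝ → ℂ := fun r => (radialCutoff r : ℂ) * e r * (a * waveAverageDeriv (a * r))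
  have h1 : Continuous f₁ := by fun_prop
  have h2 : Continuous f₂ := by fun_prop
  have h3 : Continuous f₃ := by fun_prop
  have hd : ∀ r : ℝ, HasDerivAt f₂ (f₁ r + Complex.I * κ * f₂ r + f₃ r) r := by
    intro r
    refine ((hasDerivAt_cutoff_mul_exp κ r).mul
      (hasDerivAt_comp_const_mul (hasDerivAt_waveAverage (a * r)))).congr_deriv ?_
    simp only [f₁, f₂, f₃, e]
    ring
  have hI := intervalIntegral.integral_eq_sub_of_hasDerivAt (a := 0) (b := 2)
    (fun r _ => hd r) ((by fun_prop : Continuous _).intervalIntegrable _ _)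
  rw [intervalIntegral.integral_add ((by fun_prop : Continuous _).intervalIntegrable _ _)
    (h3.intervalIntegrable _ _), intervalIntegral.integral_add (h1.intervalIntegrable _ _)
    ((by fun_prop : Continuous _).intervalIntegrable _ _),
    intervalIntegral.integral_const_mul] at hI
  have hb : f₂ 2 = 0 := by simp [f₂, radialCutoff_eq_zero]
  have hb0 : ‖f₂ 0‖ ≤ 2 * Real.pi := by
    simp only [f₂, e, radialCutoff_zero]
    simpa using norm_waveAverage_le 0
  have hn1 : ‖∫ r in (0 : ℝ)..2, f₁ r‖ ≤ 2 * (2 * Real.pi * A) + 4 * 0 := by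
    refine norm_integral_le_of_norm_le_rpow le_rfl fun r hr hr2 => ?_
    simp only [f₁, e]
    rw [norm_mul, norm_mul, norm_exp_I_mul_ofReal, mul_one, Complex.norm_real, Real.norm_eq_abs]
    nlinarith [hA r ⟨hr.le, hr2⟩, norm_waveAverage_le (a * r), abs_nonneg (deriv radialCutoff r),
      norm_nonneg (waveAverage (a * r)), Real.pi_pos]
  have hn3 : ‖∫ r in (0 : ℝ)..2, f₃ r‖ ≤ 2 * 0 + 4 * (B * √κ) := by
    refine norm_integral_le_of_norm_le_rpow (by positivity) fun r hr hr2 => ?_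
    simp only [f₃, e]
    rw [norm_mul, norm_mul, norm_exp_I_mul_ofReal, mul_one, Complex.norm_real, Real.norm_eq_abs,
      norm_mul, Complex.norm_real, Real.norm_eq_abs, abs_of_nonneg ha]
    have hp : 0 ≤ r ^ (-(1 / 2) : ℝ) := Real.rpow_nonneg hr.le _
    rcases ha.eq_or_lt with h | h
    · rw [← h]
      simp only [zero_mul, mul_zero]
      positivity
    · have h4 := mul_rpow_neg_half_le h ha le_rfl hr
      have h5 : √a ≤ √κ := Real.sqrt_le_sqrt haκ
      have h6 := abs_radialCutoff_le r
      calc |radialCutoff r| * (a * ‖waveAverageDeriv (a * r)‖)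
          ≤ 1 * (a * (B * (a * r) ^ (-(1 / 2) : ℝ))) := by
            gcongr; exact hB _ (by positivity)
        _ = B * (a * (a * r) ^ (-(1 / 2) : ℝ)) := by ring
        _ ≤ B * (√κ * r ^ (-(1 / 2) : ℝ)) := by
            exact mul_le_mul_of_nonneg_left (h4.trans (by gcongr)) hB0
        _ = _ := by ring
  have key : Complex.I * κ * ∫ r in (0 : ℝ)..2, f₂ r =
      -f₂ 0 - (∫ r in (0 : ℝ)..2, f₁ r) - ∫ r in (0 : ℝ)..2, f₃ r := by
    rw [hb] at hI
    linear_combination hI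
  have hkey : ‖∫ r in (0 : ℝ)..2, f₂ r‖ * κ =
      ‖-f₂ 0 - (∫ r in (0 : ℝ)..2, f₁ r) - ∫ r in (0 : ℝ)..2, f₃ r‖ := by
    rw [← key, norm_mul, norm_mul, Complex.norm_I, Complex.norm_real, Real.norm_eq_abs,
      abs_of_pos hκ]
    ring
  rw [hkey]
  have h7 := norm_sub_le (-f₂ 0 - ∫ r in (0 : ℝ)..2, f₁ r) (∫ r in (0 : ℝ)..2, f₃ r)
  have h8 := norm_sub_le (-f₂ 0) (∫ r in (0 : ℝ)..2, f₁ r)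
  rw [norm_neg] at h8
  have hs := Real.sqrt_nonneg κ
  nlinarith [Real.pi_pos, mul_nonneg Real.pi_pos.le hA0, mul_nonneg hB0 hs,
    mul_nonneg Real.pi_pos.le hs, mul_nonneg (mul_nonneg Real.pi_pos.le hA0) hs]

/-- The Fourier transform of the truncated kernel `e^{iκr} / r` in the plane, above the
wavenumber: one integrates `waveAverage (a r)` by parts. -/
theorem exists_bound_waveAverage_high : ∃ C : ℝ, 0 ≤ C ∧ ∀ κ a : ℝ, 0 < κ → κ ≤ a →
    ‖∫ r in (0 : ℝ)..2, (radialCutoff r : ℂ) * Complex.exp (Complex.I * (κ * r : ℝ)) *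
      waveAverage (a * r)‖ * a ≤ C * (1 + √κ) := by
  obtain ⟨A, hA0, hA⟩ := exists_abs_deriv_radialCutoff_le
  obtain ⟨K, B, hB0, hKc, hK, hKB, hKr⟩ := exists_primitive_waveAverage
  refine ⟨B + 2 * A * B + 4 * B, by positivity, fun κ a hκ hκa => ?_⟩
  have ha : 0 < a := hκ.trans_le hκa
  have hc := continuous_waveAverage
  have hX := continuous_radialCutoff
  have hX' := continuous_deriv_radialCutoff
  set e : ℝ → ℂ := fun r => Complex.exp (Complex.I * (κ * r : ℝ)) with he
  have hec : Continuous e := by fun_prop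
  set f₁ : ℝ → ℂ := fun r => (((deriv radialCutoff r : ℝ) : ℂ) * e r +
    Complex.I * κ * ((radialCutoff r : ℂ) * e r)) * K (a * r)
  set f₂ : ℝ → ℂ := fun r => (radialCutoff r : ℂ) * e r * waveAverage (a * r)
  set P : ℝ → ℂ := fun r => (radialCutoff r : ℂ) * e r * K (a * r)
  have h1 : Continuous f₁ := by fun_prop
  have h2 : Continuous f₂ := by fun_prop
  have hP : Continuous P := by fun_prop
  have hd : ∀ r ∈ Set.Ioo (0 : ℝ) 2, HasDerivAt P (f₁ r + a * f₂ r) r := by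
    intro r hr
    refine ((hasDerivAt_cutoff_mul_exp κ r).mul
      (hasDerivAt_comp_const_mul (hK (a * r) (mul_pos ha hr.1)))).congr_deriv ?_
    simp only [f₁, f₂, e]
    ring
  have hI := intervalIntegral.integral_eq_sub_of_hasDerivAt_of_le (zero_le_two)
    hP.continuousOn hd ((by fun_prop : Continuous _).intervalIntegrable _ _)
  rw [intervalIntegral.integral_add (h1.intervalIntegrable _ _)
    ((by fun_prop : Continuous _).intervalIntegrable _ _),
    intervalIntegral.integral_const_mul] at hI
  have hb : P 2 = 0 := by simp [P, radialCutoff_eq_zero]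
  have hb0 : ‖P 0‖ ≤ B := by
    simp only [P, e, radialCutoff_zero]
    simpa using hKB 0 le_rfl
  have hn1 : ‖∫ r in (0 : ℝ)..2, f₁ r‖ ≤ 2 * (A * B) + 4 * (B * √κ) := by
    refine norm_integral_le_of_norm_le_rpow (by positivity) fun r hr hr2 => ?_
    simp only [f₁, e]
    have har : 0 < a * r := mul_pos ha hr
    have h4 := mul_rpow_neg_half_le ha hκ.le hκa hr
    rw [add_mul]
    refine (norm_add_le _ _).trans (add_le_add ?_ ?_)
    · rw [norm_mul, norm_mul, norm_exp_I_mul_ofReal, mul_one, Complex.norm_real, Real.norm_eq_abs]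
      exact mul_le_mul (hA r ⟨hr.le, hr2⟩) (hKB _ har.le) (norm_nonneg _) hA0
    · rw [norm_mul, norm_mul, norm_mul, norm_mul, norm_exp_I_mul_ofReal, mul_one, Complex.norm_real,
        Complex.norm_real, Complex.norm_I, one_mul, Real.norm_eq_abs, Real.norm_eq_abs,
        abs_of_pos hκ]
      calc κ * |radialCutoff r| * ‖K (a * r)‖
          ≤ κ * 1 * (B * (a * r) ^ (-(1 / 2) : ℝ)) := by
            gcongr
            · exact abs_radialCutoff_le r
            · exact hKr _ har
        _ = B * (κ * (a * r) ^ (-(1 / 2) : ℝ)) := by ring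
        _ ≤ B * (√κ * r ^ (-(1 / 2) : ℝ)) := by gcongr
        _ = _ := by ring
  have key : a * ∫ r in (0 : ℝ)..2, f₂ r = -P 0 - ∫ r in (0 : ℝ)..2, f₁ r := by
    rw [hb] at hI
    linear_combination hI
  have hkey : ‖∫ r in (0 : ℝ)..2, f₂ r‖ * a = ‖-P 0 - ∫ r in (0 : ℝ)..2, f₁ r‖ := by
    rw [← key, norm_mul, Complex.norm_real, Real.norm_eq_abs, abs_of_pos ha]
    ring
  rw [hkey]
  have h8 := norm_sub_le (-P 0) (∫ r in (0 : ℝ)..2, f₁ r)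
  rw [norm_neg] at h8
  have hs := Real.sqrt_nonneg κ
  nlinarith [mul_nonneg hB0 hs, mul_nonneg hA0 hB0, mul_nonneg (mul_nonneg hA0 hB0) hs]

/-! ### Truncated sine integrals -/

/-- The sine integral `∫₀ᶻ sin u / u du` is bounded, because it differs by `O(1/z)` from an
increasing and from a decreasing function on `[1, ∞)`. -/
theorem exists_abs_integral_sinc_le :
    ∃ C : ℝ, 0 ≤ C ∧ ∀ z, 0 ≤ z → |∫ u in (0 : ℝ)..z, Real.sinc u| ≤ C := by
  set S : ℝ → ℝ := fun z => ∫ u in (0 : ℝ)..z, Real.sinc u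
  have hS : ∀ z, HasDerivAt S (Real.sinc z) z := fun z =>
    intervalIntegral.integral_hasDerivAt_right (Real.continuous_sinc.intervalIntegrable _ _)
      (Real.continuous_sinc.stronglyMeasurableAtFilter _ _) Real.continuous_sinc.continuousAt
  have h01 : ∀ z, 0 ≤ z → z ≤ 1 → |S z| ≤ 1 := by
    intro z hz hz1
    have := intervalIntegral.norm_integral_le_of_norm_le_const (a := 0) (b := z) (C := 1)
      (f := Real.sinc) (fun u _ => Real.abs_sinc_le_one u)
    rw [sub_zero, abs_of_nonneg hz, one_mul] at this
    exact this.trans hz1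
  have hd : ∀ z > 0, ∀ s : ℝ, HasDerivAt (fun z => S z + (Real.cos z + s) / z)
      (-((Real.cos z + s) / z ^ 2)) z := by
    intro z hz s
    refine ((hS z).add (((Real.hasDerivAt_cos z).add_const s).div (hasDerivAt_id z)
      hz.ne')).congr_deriv ?_
    rw [Real.sinc_of_ne_zero hz.ne']
    simp only [id]
    field_simp
    ring
  -- the corrections `(cos z ∓ 1) / z` make the derivative `(±1 - cos z) / z²` of one sign
  have hmono : MonotoneOn (fun z => S z + (Real.cos z + -1) / z) (Set.Ici 1) := by
    refine monotoneOn_of_deriv_nonneg (convex_Ici 1)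
      (fun z hz => (hd z (one_pos.trans_le hz) _).continuousAt.continuousWithinAt)
      (fun z hz => ?_) fun z hz => ?_
    · rw [interior_Ici] at hz
      exact (hd z (one_pos.trans hz) _).differentiableAt.differentiableWithinAt
    · rw [interior_Ici] at hz
      rw [(hd z (one_pos.trans hz) _).deriv, ← neg_div]
      exact div_nonneg (by linarith [Real.cos_le_one z]) (sq_nonneg z)
  have hanti : AntitoneOn (fun z => S z + (Real.cos z + 1) / z) (Set.Ici 1) := by
    refine antitoneOn_of_deriv_nonpos (convex_Ici 1)
      (fun z hz => (hd z (one_pos.trans_le hz) _).continuousAt.continuousWithinAt)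
      (fun z hz => ?_) fun z hz => ?_
    · rw [interior_Ici] at hz
      exact (hd z (one_pos.trans hz) _).differentiableAt.differentiableWithinAt
    · rw [interior_Ici] at hz
      rw [(hd z (one_pos.trans hz) _).deriv, neg_nonpos]
      exact div_nonneg (by linarith [Real.neg_one_le_cos z]) (sq_nonneg z)
  refine ⟨3, by norm_num, fun z hz => ?_⟩
  rcases le_total z 1 with h | h
  · exact (h01 z hz h).trans (by norm_num)
  · have hz0 : 0 < z := by linarith
    have a1 := hmono (Set.mem_Ici.2 le_rfl) (Set.mem_Ici.2 h) h
    have a2 := hanti (Set.mem_Ici.2 le_rfl) (Set.mem_Ici.2 h) h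
    simp only [div_one] at a1 a2
    have b1 : (Real.cos z + -1) / z ≤ 0 :=
      div_nonpos_of_nonpos_of_nonneg (by linarith [Real.cos_le_one z]) hz0.le
    have b2 : 0 ≤ (Real.cos z + 1) / z :=
      div_nonneg (by linarith [Real.neg_one_le_cos z]) hz0.le
    have b3 := abs_le.1 (h01 1 zero_le_one le_rfl)
    change |S z| ≤ 3
    rw [abs_le]
    constructor <;> linarith [Real.cos_le_one 1, Real.neg_one_le_cos 1]

theorem exists_abs_integral_cutoff_sinc_le :
    ∃ C : ℝ, 0 ≤ C ∧ ∀ a, 0 ≤ a →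
      |∫ r in (0 : ℝ)..2, radialCutoff r * (a * Real.sinc (a * r))| ≤ C := by
  obtain ⟨A, hA0, hA⟩ := exists_abs_deriv_radialCutoff_le
  obtain ⟨B, hB0, hB⟩ := exists_abs_integral_sinc_le
  refine ⟨2 * (A * B), by positivity, fun a ha => ?_⟩
  have hX := continuous_radialCutoff
  have hX' := continuous_deriv_radialCutoff
  have hs := Real.continuous_sinc
  set S : ℝ → ℝ := fun z => ∫ u in (0 : ℝ)..z, Real.sinc u with hSdef
  have hS : ∀ z, HasDerivAt S (Real.sinc z) z := fun z =>
    intervalIntegral.integral_hasDerivAt_right (hs.intervalIntegrable _ _)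
      (hs.stronglyMeasurableAtFilter _ _) hs.continuousAt
  have hSc : Continuous S := continuous_iff_continuousAt.2 fun z => (hS z).continuousAt
  have hd : ∀ r : ℝ, HasDerivAt (fun r => radialCutoff r * S (a * r))
      (deriv radialCutoff r * S (a * r) + radialCutoff r * (a * Real.sinc (a * r))) r := by
    intro r
    refine ((hasDerivAt_radialCutoff r).mul
      ((hS (a * r)).comp r ((hasDerivAt_id r).const_mul a))).congr_deriv ?_
    simp only [Function.comp]
    ring
  have hI := intervalIntegral.integral_eq_sub_of_hasDerivAt (a := 0) (b := 2)
    (fun r _ => hd r) ((by fun_prop : Continuous _).intervalIntegrable _ _)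
  rw [intervalIntegral.integral_add ((by fun_prop : Continuous _).intervalIntegrable _ _)
    ((by fun_prop : Continuous _).intervalIntegrable _ _), radialCutoff_eq_zero le_rfl] at hI
  have h0 : S (a * 0) = 0 := by simp [hSdef]
  rw [h0, zero_mul, mul_zero, sub_zero] at hI
  have h1 : ∫ r in (0 : ℝ)..2, radialCutoff r * (a * Real.sinc (a * r)) =
      -∫ r in (0 : ℝ)..2, deriv radialCutoff r * S (a * r) := by linarith
  rw [h1, abs_neg]
  have h2 := intervalIntegral.norm_integral_le_of_norm_le_const (a := 0) (b := 2) (C := A * B)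
    (f := fun r => deriv radialCutoff r * S (a * r)) (fun r hr => by
      rw [Set.uIoc_of_le zero_le_two] at hr
      rw [norm_mul]
      exact mul_le_mul (hA r ⟨hr.1.le, hr.2⟩) (hB _ (mul_nonneg ha hr.1.le)) (norm_nonneg _) hA0)
  rw [Real.norm_eq_abs] at h2
  refine h2.trans (le_of_eq ?_)
  norm_num
  ring

/-! ### Oscillatory integrals of the Hankel function -/

theorem one_le_two_mul_log_two_add_inv {z : ℝ} (hz : 0 < z) : 1 ≤ 2 * Real.log (2 + z⁻¹) := by
  linarith [log_two_le_log_two_add_inv hz]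

theorem mul_rpow_neg_half_eq {κ r : ℝ} (hκ : 0 < κ) (hr : 0 < r) :
    κ * (κ * r) ^ (-(1 / 2) : ℝ) = √κ * r ^ (-(1 / 2) : ℝ) := by
  rw [Real.mul_rpow hκ.le hr.le, ← mul_assoc]
  congr 1
  rw [Real.sqrt_eq_rpow]
  nth_rewrite 1 [← Real.rpow_one κ]
  rw [← Real.rpow_add hκ]
  norm_num

/-- The Fourier transform of the truncated kernel `H₀⁽¹⁾(κ r)` on the line. The bound holds for all
frequencies `a`, but is only sharp enough below the wavenumber. -/
theorem exists_bound_hankelH0_low : ∃ C : ℝ, 0 ≤ C ∧ ∀ κ a : ℝ, 0 < κ →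
    ‖∫ r in (0 : ℝ)..2, (radialCutoff r : ℂ) * hankelH0 (κ * r) * Real.cos (a * r)‖ * κ ≤
      C * √κ := by
  obtain ⟨B, hB0, hB⟩ := exists_norm_hankelH0_le_rpow
  refine ⟨4 * B, by positivity, fun κ a hκ => ?_⟩
  have hκ' : 0 < √κ := Real.sqrt_pos.2 hκ
  have h := norm_integral_le_of_norm_le_rpow (A := 0) (B := B / √κ) (by positivity)
    (f := fun r => (radialCutoff r : ℂ) * hankelH0 (κ * r) * Real.cos (a * r)) fun r hr hr2 => by
      rw [norm_mul, norm_mul, Complex.norm_real, Complex.norm_real, Real.norm_eq_abs,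
        Real.norm_eq_abs]
      calc |radialCutoff r| * ‖hankelH0 (κ * r)‖ * |Real.cos (a * r)|
          ≤ 1 * (B * (κ * r) ^ (-(1 / 2) : ℝ)) * 1 := by
            gcongr
            · exact abs_radialCutoff_le r
            · exact hB _ (mul_pos hκ hr)
            · exact Real.abs_cos_le_one _
        _ = B / κ * (κ * (κ * r) ^ (-(1 / 2) : ℝ)) := by field_simp
        _ = 0 + B / √κ * r ^ (-(1 / 2) : ℝ) := by
            rw [mul_rpow_neg_half_eq hκ hr]
            nth_rewrite 1 [← Real.mul_self_sqrt hκ.le]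
            field_simp
            ring
  calc _ ≤ (2 * 0 + 4 * (B / √κ)) * κ := by gcongr
    _ = 4 * B * √κ := by
      nth_rewrite 2 [← Real.mul_self_sqrt hκ.le]
      field_simp
      ring

theorem continuousOn_hankelH0_comp {κ : ℝ} (hκ : 0 < κ) :
    ContinuousOn (fun r => hankelH0 (κ * r)) (Set.Ioi 0) := fun r hr =>
  ((hasDerivAt_hankelH0 (mul_pos hκ hr).ne').continuousAt.comp_of_eq
    (by fun_prop : ContinuousAt (fun r => κ * r) r) rfl).continuousWithinAt

theorem continuousOn_hankelH0Deriv_comp {κ : ℝ} (hκ : 0 < κ) :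
    ContinuousOn (fun r => hankelH0Deriv (κ * r)) (Set.Ioi 0) := fun r hr =>
  ((hasDerivAt_hankelH0Deriv (mul_pos hκ hr).ne').continuousAt.comp_of_eq
    (by fun_prop : ContinuousAt (fun r => κ * r) r) rfl).continuousWithinAt

theorem intervalIntegrable_of_norm_le_rpow {f : ℝ → ℂ} {A B : ℝ}
    (hc : ContinuousOn f (Set.Ioi 0))
    (hf : ∀ r, 0 < r → r ≤ 2 → ‖f r‖ ≤ A + B * r ^ (-(1 / 2) : ℝ)) :
    IntervalIntegrable f volume 0 2 := by
  have hi : IntervalIntegrable (fun r : ℝ => A + B * r ^ (-(1 / 2) : ℝ)) volume 0 2 :=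
    intervalIntegrable_const.add ((intervalIntegrable_rpow_neg_half 0 2).const_mul B)
  refine hi.mono_fun' ?_ ?_
  · rw [Set.uIoc_of_le zero_le_two]
    exact (hc.mono fun r hr => hr.1).aestronglyMeasurable measurableSet_Ioc
  · rw [Set.uIoc_of_le zero_le_two]
    exact (ae_restrict_iff' measurableSet_Ioc).2 (Eventually.of_forall fun r hr => hf r hr.1 hr.2)

/-- The Fourier transform of the truncated kernel `H₀⁽¹⁾(κ r)` on the line, above the wavenumber:
one integrates the cosine by parts, and splits off the singularity `c / (κ r)` of the derivative of
the Hankel function. -/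
theorem exists_bound_hankelH0_high : ∃ C : ℝ, 0 ≤ C ∧ ∀ κ a : ℝ, 0 < κ → κ ≤ a →
    ‖∫ r in (0 : ℝ)..2, (radialCutoff r : ℂ) * hankelH0 (κ * r) * Real.cos (a * r)‖ * a ≤
      C * (Real.log (2 + κ⁻¹) * (1 + √κ)) := by
  obtain ⟨A, hA0, hA⟩ := exists_abs_deriv_radialCutoff_le
  obtain ⟨B, hB0, hB⟩ := exists_norm_hankelH0_le_rpow
  obtain ⟨L, hL0, hL⟩ := exists_norm_hankelH0_le_log
  obtain ⟨c, D, hD0, hD⟩ := exists_norm_hankelH0Deriv_sub_le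
  obtain ⟨S, hS0, hS⟩ := exists_abs_integral_cutoff_sinc_le
  refine ⟨2 * (A * L) + 2 * (4 * D + ‖c‖ * S), by positivity, fun κ a hκ hκa => ?_⟩
  have ha : 0 < a := hκ.trans_le hκa
  have hX := continuous_radialCutoff
  have hX' := continuous_deriv_radialCutoff
  have hsi := Real.continuous_sinc
  have hHc := continuousOn_hankelH0_comp hκ
  have hHc' := continuousOn_hankelH0Deriv_comp hκ
  have hlog : 0 < Real.log (2 + κ⁻¹) := by linarith [log_two_le_log_two_add_inv hκ]
  set f₁ : ℝ → ℂ := fun r => ((deriv radialCutoff r : ℝ) : ℂ) * hankelH0 (κ * r) *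
    Real.sin (a * r) with hf₁
  set f₂ : ℝ → ℂ := fun r => (radialCutoff r : ℂ) * (κ * (hankelH0Deriv (κ * r) -
    c / (κ * r : ℝ))) * Real.sin (a * r) with hf₂
  set f₃ : ℝ → ℝ := fun r => radialCutoff r * (a * Real.sinc (a * r)) with hf₃
  set f₄ : ℝ → ℂ := fun r => (radialCutoff r : ℂ) * hankelH0 (κ * r) * Real.cos (a * r) with hf₄
  set P : ℝ → ℂ := fun r => (radialCutoff r : ℂ) * hankelH0 (κ * r) * Real.sin (a * r) with hP
  have hf₃c : Continuous f₃ := by fun_prop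
  have hκr : ∀ r > 0, B * (κ * r) ^ (-(1 / 2) : ℝ) = B * κ ^ (-(1 / 2) : ℝ) *
      r ^ (-(1 / 2) : ℝ) := fun r hr => by rw [Real.mul_rpow hκ.le hr.le, mul_assoc]
  have hb1 : ∀ r, 0 < r → r ≤ 2 → ‖f₁ r‖ ≤ A * (L * Real.log (2 + κ⁻¹)) +
      0 * r ^ (-(1 / 2) : ℝ) := by
    intro r hr hr2
    rw [zero_mul, add_zero, hf₁]
    simp only
    rw [norm_mul, norm_mul, Complex.norm_real, Complex.norm_real, Real.norm_eq_abs,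
      Real.norm_eq_abs]
    rcases le_total r 1 with h | h
    · rw [deriv_radialCutoff_eq_zero hr.le h]
      simp only [abs_zero, zero_mul]
      positivity
    · have h1 : Real.log (2 + (κ * r)⁻¹) ≤ Real.log (2 + κ⁻¹) := by
        refine Real.log_le_log (by positivity) ?_
        gcongr
        exact le_mul_of_one_le_right hκ.le h
      calc |deriv radialCutoff r| * ‖hankelH0 (κ * r)‖ * |Real.sin (a * r)|
          ≤ A * (L * Real.log (2 + κ⁻¹)) * 1 := by
            gcongr
            · exact hA r ⟨hr.le, hr2⟩
            · exact (hL _ (mul_pos hκ hr)).trans (by gcongr)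
            · exact Real.abs_sin_le_one _
        _ = _ := mul_one _
  have hb2 : ∀ r, 0 < r → r ≤ 2 → ‖f₂ r‖ ≤ 0 + D * √κ * r ^ (-(1 / 2) : ℝ) := by
    intro r hr hr2
    rw [zero_add, hf₂]
    simp only
    rw [norm_mul, norm_mul, norm_mul, Complex.norm_real, Complex.norm_real, Complex.norm_real,
      Real.norm_eq_abs, Real.norm_eq_abs, Real.norm_eq_abs, abs_of_pos hκ]
    calc |radialCutoff r| * (κ * ‖hankelH0Deriv (κ * r) - c / (κ * r : ℝ)‖) * |Real.sin (a * r)|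
        ≤ 1 * (κ * (D * (κ * r) ^ (-(1 / 2) : ℝ))) * 1 := by
          gcongr
          · exact abs_radialCutoff_le r
          · exact hD _ (mul_pos hκ hr)
          · exact Real.abs_sin_le_one _
      _ = D * (κ * (κ * r) ^ (-(1 / 2) : ℝ)) := by ring
      _ = _ := by rw [mul_rpow_neg_half_eq hκ hr]; ring
  have hb4 : ∀ r, 0 < r → r ≤ 2 → ‖f₄ r‖ ≤
      0 + B * κ ^ (-(1 / 2) : ℝ) * r ^ (-(1 / 2) : ℝ) := by
    intro r hr hr2
    rw [zero_add, hf₄]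
    simp only
    rw [norm_mul, norm_mul, Complex.norm_real, Complex.norm_real, Real.norm_eq_abs,
      Real.norm_eq_abs, ← hκr r hr]
    calc |radialCutoff r| * ‖hankelH0 (κ * r)‖ * |Real.cos (a * r)|
        ≤ 1 * (B * (κ * r) ^ (-(1 / 2) : ℝ)) * 1 := by
          gcongr
          · exact abs_radialCutoff_le r
          · exact hB _ (mul_pos hκ hr)
          · exact Real.abs_cos_le_one _
      _ = _ := by ring
  have hi1 : IntervalIntegrable f₁ volume 0 2 := intervalIntegrable_of_norm_le_rpow
    (((by fun_prop : Continuous fun r => ((deriv radialCutoff r : ℝ) : ℂ)).continuousOn.mul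
      hHc).mul (by fun_prop : Continuous fun r : ℝ => (Real.sin (a * r) : ℂ)).continuousOn) hb1
  have hi2 : IntervalIntegrable f₂ volume 0 2 := by
    refine intervalIntegrable_of_norm_le_rpow ?_ hb2
    refine (((by fun_prop : Continuous fun r => (radialCutoff r : ℂ)).continuousOn.mul
      (continuousOn_const.mul (hHc'.sub ?_)))).mul
        (by fun_prop : Continuous fun r : ℝ => (Real.sin (a * r) : ℂ)).continuousOn
    exact continuousOn_const.div (by fun_prop) fun r hr => by
      exact_mod_cast (mul_pos hκ hr).ne'
  have hi3 : IntervalIntegrable (fun r => c * (f₃ r : ℂ)) volume 0 2 :=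
    (by fun_prop : Continuous fun r => c * (f₃ r : ℂ)).intervalIntegrable _ _
  have hi4 : IntervalIntegrable f₄ volume 0 2 := intervalIntegrable_of_norm_le_rpow
    (((by fun_prop : Continuous fun r => (radialCutoff r : ℂ)).continuousOn.mul
      hHc).mul (by fun_prop : Continuous fun r : ℝ => (Real.cos (a * r) : ℂ)).continuousOn) hb4
  have hd : ∀ r ∈ Set.Ioo (0 : ℝ) 2, HasDerivAt P (f₁ r + f₂ r + c * f₃ r + a * f₄ r) r := by
    intro r hr
    have hκr0 : κ * r ≠ 0 := (mul_pos hκ hr.1).ne'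
    have h1 := ((hasDerivAt_radialCutoff r).ofReal_comp.mul
      (hasDerivAt_comp_const_mul (hasDerivAt_hankelH0 hκr0))).mul
      ((Real.hasDerivAt_sin (a * r)).comp r ((hasDerivAt_id r).const_mul a)).ofReal_comp
    refine h1.congr_deriv ?_
    simp only [hf₁, hf₂, hf₃, hf₄, Real.sinc_of_ne_zero (mul_pos ha hr.1).ne', Function.comp,
      Pi.mul_apply]
    have e1 : (κ : ℂ) ≠ 0 := by exact_mod_cast hκ.ne'
    have e2 : (a : ℂ) ≠ 0 := by exact_mod_cast ha.ne'
    have e3 : (r : ℂ) ≠ 0 := by exact_mod_cast hr.1.ne'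
    push_cast
    field_simp
    ring
  have hPc : ContinuousOn P (Set.Icc 0 2) := by
    intro r hr
    rcases hr.1.eq_or_lt with h | h
    · -- the zero of the sine compensates the logarithmic singularity
      rw [← h]
      have hP0 : P 0 = 0 := by simp [hP]
      refine ContinuousWithinAt.mono ?_ Set.Icc_subset_Ici_self
      rw [ContinuousWithinAt, hP0]
      have hlim : Tendsto (fun r : ℝ => B * κ ^ (-(1 / 2) : ℝ) * a * r ^ (1 / 2 : ℝ))
          (𝓝[Set.Ici 0] 0) (𝓝 0) := by
        have hc : Continuous (fun r : ℝ => B * κ ^ (-(1 / 2) : ℝ) * a * r ^ (1 / 2 : ℝ)) :=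
          continuous_const.mul (Real.continuous_rpow_const (by norm_num))
        have := hc.tendsto 0
        rw [Real.zero_rpow (by norm_num), mul_zero] at this
        exact this.mono_left nhdsWithin_le_nhds
      refine squeeze_zero_norm' ?_ hlim
      filter_upwards [self_mem_nhdsWithin] with x hx
      rcases (show (0 : ℝ) ≤ x from hx).eq_or_lt with h0 | h0
      · rw [← h0, hP0, norm_zero, Real.zero_rpow (by norm_num), mul_zero]
      · rw [hP]
        simp only
        rw [norm_mul, norm_mul, Complex.norm_real, Complex.norm_real, Real.norm_eq_abs,
          Real.norm_eq_abs]
        have hsin : |Real.sin (a * x)| ≤ a * x := by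
          have := Real.abs_sin_le_abs (x := a * x)
          rwa [abs_of_pos (mul_pos ha h0)] at this
        calc |radialCutoff x| * ‖hankelH0 (κ * x)‖ * |Real.sin (a * x)|
            ≤ 1 * (B * (κ * x) ^ (-(1 / 2) : ℝ)) * (a * x) := by
              gcongr
              · exact abs_radialCutoff_le x
              · exact hB _ (mul_pos hκ h0)
          _ = B * κ ^ (-(1 / 2) : ℝ) * a * (x * x ^ (-(1 / 2) : ℝ)) := by
              rw [hκr x h0]; ring
          _ = _ := by
              congr 1
              nth_rewrite 1 [← Real.rpow_one x]
              rw [← Real.rpow_add h0]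
              norm_num
    · exact (((by fun_prop : ContinuousAt (fun r => (radialCutoff r : ℂ)) r).mul
        ((hHc r h).continuousAt (Ioi_mem_nhds h))).mul
        (by fun_prop : ContinuousAt (fun r : ℝ => (Real.sin (a * r) : ℂ)) r)).continuousWithinAt
  have hI := intervalIntegral.integral_eq_sub_of_hasDerivAt_of_le zero_le_two hPc hd
    (((hi1.add hi2).add hi3).add (hi4.const_mul a))
  rw [intervalIntegral.integral_add ((hi1.add hi2).add hi3) (hi4.const_mul a),
    intervalIntegral.integral_add (hi1.add hi2) hi3, intervalIntegral.integral_add hi1 hi2,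
    intervalIntegral.integral_const_mul, intervalIntegral.integral_const_mul,
    intervalIntegral.integral_ofReal] at hI
  have hP2 : P 2 = 0 := by simp [hP, radialCutoff_eq_zero]
  have hP0 : P 0 = 0 := by simp [hP]
  rw [hP2, hP0, sub_zero] at hI
  have key : a * ∫ r in (0 : ℝ)..2, f₄ r = -(∫ r in (0 : ℝ)..2, f₁ r) -
      (∫ r in (0 : ℝ)..2, f₂ r) - c * ((∫ r in (0 : ℝ)..2, f₃ r : ℝ) : ℂ) := by
    linear_combination hI
  have hkey : ‖∫ r in (0 : ℝ)..2, f₄ r‖ * a = ‖-(∫ r in (0 : ℝ)..2, f₁ r) -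
      (∫ r in (0 : ℝ)..2, f₂ r) - c * ((∫ r in (0 : ℝ)..2, f₃ r : ℝ) : ℂ)‖ := by
    rw [← key, norm_mul, Complex.norm_real, Real.norm_eq_abs, abs_of_pos ha]
    ring
  rw [hkey]
  have n1 := norm_integral_le_of_norm_le_rpow le_rfl hb1
  have n2 := norm_integral_le_of_norm_le_rpow (by positivity) hb2
  have n3 : ‖c * ((∫ r in (0 : ℝ)..2, f₃ r : ℝ) : ℂ)‖ ≤ ‖c‖ * S := by
    rw [norm_mul, Complex.norm_real]
    exact mul_le_mul_of_nonneg_left (hS a ha.le) (norm_nonneg _)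
  have n4 := norm_sub_le (-(∫ r in (0 : ℝ)..2, f₁ r) - (∫ r in (0 : ℝ)..2, f₂ r))
    (c * ((∫ r in (0 : ℝ)..2, f₃ r : ℝ) : ℂ))
  have n5 := norm_sub_le (-(∫ r in (0 : ℝ)..2, f₁ r)) (∫ r in (0 : ℝ)..2, f₂ r)
  rw [norm_neg] at n5
  have hs := Real.sqrt_nonneg κ
  have hone := one_le_two_mul_log_two_add_inv hκ
  set l := Real.log (2 + κ⁻¹)
  have hc0 := norm_nonneg c
  have t1 : 2 * (A * (L * l)) ≤ 2 * (A * L) * (l * (1 + √κ)) := by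
    have : 0 ≤ 2 * (A * L) * (l * √κ) := by positivity
    linarith
  have t2 : 4 * (D * √κ) + ‖c‖ * S ≤ (4 * D + ‖c‖ * S) * (1 + √κ) := by
    have : 0 ≤ ‖c‖ * S * √κ := by positivity
    linarith
  have t3 : (4 * D + ‖c‖ * S) * (1 + √κ) ≤ (4 * D + ‖c‖ * S) * (1 + √κ) * (2 * l) :=
    le_mul_of_one_le_right (by positivity) hone
  linarith

/-! ### Sobolev distributions as weighted square-integrable functions on the Fourier side -/

section FourierSide

variable {E : Type*} [NormedAddCommGroup E] [InnerProductSpace ℝ E] [FiniteDimensional ℝ E]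
  [MeasurableSpace E] [BorelSpace E]

/-- The symbol `(k² + |2πξ|²)^(s/2)` of the Bessel potential operator. -/
def besselSymbol (k s : ℝ) (ξ : E) : ℂ :=
  (((k ^ 2 + (2 * Real.pi * ‖ξ‖) ^ 2) ^ (s / 2) : ℝ) : ℂ)

omit [FiniteDimensional ℝ E] [MeasurableSpace E] [BorelSpace E] in
theorem hasTemperateGrowth_besselSymbol {k : ℝ} (hk : 0 < k) (s : ℝ) :
    Function.HasTemperateGrowth (besselSymbol k s : E → ℂ) := by
  have h1 := Function.hasTemperateGrowth_one_add_norm_sq_rpow E (s / 2)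
  have h2 := (h1.comp (((2 * Real.pi / k) • ContinuousLinearMap.id ℝ E)).hasTemperateGrowth)
  have h3 : Function.HasTemperateGrowth fun ξ : E =>
      (((k ^ 2) ^ (s / 2) : ℝ) : ℂ) * Complex.ofReal
        ((1 + ‖((2 * Real.pi / k) • ContinuousLinearMap.id ℝ E) ξ‖ ^ 2) ^ (s / 2)) :=
    (Function.HasTemperateGrowth.const _).mul (Complex.ofRealCLM.hasTemperateGrowth.comp h2)
  convert h3 using 1
  ext ξ
  rw [besselSymbol, ← Complex.ofReal_mul, ← Real.mul_rpow (sq_nonneg k) (by positivity)]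
  congr 2
  simp only [smul_apply, ContinuousLinearMap.id_apply, norm_smul, Real.norm_eq_abs,
    mul_pow, sq_abs]
  field_simp

omit [InnerProductSpace ℝ E] [FiniteDimensional ℝ E] [MeasurableSpace E] [BorelSpace E] in
theorem besselSymbol_base_pos {k : ℝ} (hk : 0 < k) (ξ : E) :
    0 < k ^ 2 + (2 * Real.pi * ‖ξ‖) ^ 2 := by positivity

omit [InnerProductSpace ℝ E] [FiniteDimensional ℝ E] [MeasurableSpace E] [BorelSpace E] in
theorem besselSymbol_add {k : ℝ} (hk : 0 < k) (s t : ℝ) (ξ : E) :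
    besselSymbol k (s + t) ξ = besselSymbol k s ξ * besselSymbol k t ξ := by
  rw [besselSymbol, besselSymbol, besselSymbol, ← Complex.ofReal_mul,
    ← Real.rpow_add (besselSymbol_base_pos hk ξ), add_div]

omit [InnerProductSpace ℝ E] [FiniteDimensional ℝ E] [MeasurableSpace E] [BorelSpace E] in
theorem besselSymbol_mul_neg {k : ℝ} (hk : 0 < k) (s : ℝ) :
    (besselSymbol k s * besselSymbol k (-s) : E → ℂ) = fun _ => 1 := by
  ext ξ
  rw [Pi.mul_apply, ← besselSymbol_add hk, add_neg_cancel, besselSymbol]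
  simp

omit [InnerProductSpace ℝ E] [FiniteDimensional ℝ E] [MeasurableSpace E] [BorelSpace E] in
theorem continuous_besselSymbol {k : ℝ} (hk : 0 < k) (s : ℝ) :
    Continuous (besselSymbol k s : E → ℂ) :=
  Complex.continuous_ofReal.comp ((by fun_prop : Continuous fun ξ : E =>
    k ^ 2 + (2 * Real.pi * ‖ξ‖) ^ 2).rpow_const fun ξ => Or.inl (besselSymbol_base_pos hk ξ).ne')

theorem besselPotential_eq (k s : ℝ) : (besselPotential k s : 𝓢'(E, ℂ) →L[ℂ] 𝓢'(E, ℂ)) =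
    TemperedDistribution.fourierMultiplierCLM ℂ (besselSymbol k s) := rfl

theorem besselPotential_neg_apply {k : ℝ} (hk : 0 < k) (s : ℝ) (u : 𝓢'(E, ℂ)) :
    besselPotential k s (besselPotential k (-s) u) = u := by
  rw [besselPotential_eq, besselPotential_eq,
    TemperedDistribution.fourierMultiplierCLM_fourierMultiplierCLM_apply
      (hasTemperateGrowth_besselSymbol hk _) (hasTemperateGrowth_besselSymbol hk _),
    mul_comm, besselSymbol_mul_neg hk]
  simp

theorem besselPotential_neg_apply' {k : ℝ} (hk : 0 < k) (s : ℝ) (u : 𝓢'(E, ℂ)) :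
    besselPotential k (-s) (besselPotential k s u) = u := by
  simpa using besselPotential_neg_apply hk (-s) u

/-- The action of a distribution in `Hˢ` on Schwartz functions, on the Fourier side. -/
theorem apply_eq_integral_of_besselPotential_eq {k s : ℝ} (hk : 0 < k) {u : 𝓢'(E, ℂ)}
    {f : Lp ℂ 2 (volume : Measure E)} (hf : besselPotential k s u = f) (g : 𝓢(E, ℂ)) :
    u g = ∫ ξ, besselSymbol k (-s) ξ * (𝓕⁻ g) ξ * (𝓕 f : Lp ℂ 2 (volume : Measure E)) ξ := by
  rw [← besselPotential_neg_apply' hk s u, hf, besselPotential_eq,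
    TemperedDistribution.fourierMultiplierCLM_apply_apply, ← TemperedDistribution.fourier_apply,
    Lp.fourier_toTemperedDistribution_eq, Lp.toTemperedDistribution_apply]
  simp_rw [SchwartzMap.smulLeftCLM_apply_apply (hasTemperateGrowth_besselSymbol hk (-s)),
    smul_eq_mul]

/-- The square-integrable function `𝒥ₖˢ u`, for `u ∈ Hˢ`. -/
def sobolevToL2 (k s : ℝ) : sobolevSpace E k s →ₗ[ℂ] Lp ℂ 2 (volume : Measure E) :=
  (LinearEquiv.ofInjective
    (Lp.toTemperedDistributionCLM ℂ (volume : Measure E) 2).toLinearMap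
    (LinearMap.ker_eq_bot.1
      (Lp.ker_toTemperedDistributionCLM_eq_bot (F := ℂ) (μ := (volume : Measure E)) (p := 2)))
    ).symm.toLinearMap ∘ₗ
  ((besselPotential k s).toLinearMap.domRestrict (sobolevSpace E k s)).codRestrict _ fun u => u.2

theorem besselPotential_eq_sobolevToL2 {k s : ℝ} (u : sobolevSpace E k s) :
    besselPotential k s (u : 𝓢'(E, ℂ)) = (sobolevToL2 k s u : Lp ℂ 2 (volume : Measure E)) := by
  have h := (LinearEquiv.ofInjective
    (Lp.toTemperedDistributionCLM ℂ (volume : Measure E) 2).toLinearMap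
    (LinearMap.ker_eq_bot.1
      (Lp.ker_toTemperedDistributionCLM_eq_bot (F := ℂ) (μ := (volume : Measure E)) (p := 2)))
    ).apply_symm_apply
      (((besselPotential k s).toLinearMap.domRestrict (sobolevSpace E k s)).codRestrict _
        (fun u => u.2) u)
  exact (congrArg Subtype.val h).symm

/-- The distribution `u ∈ Hˢ` with `𝒥ₖˢ u = f`, for a square-integrable `f`. -/
def sobolevOfL2 {k : ℝ} (hk : 0 < k) (s : ℝ) :
    Lp ℂ 2 (volume : Measure E) →ₗ[ℂ] sobolevSpace E k s :=
  ((besselPotential k (-s)).toLinearMap ∘ₗ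
    (Lp.toTemperedDistributionCLM ℂ (volume : Measure E) 2).toLinearMap).codRestrict _
    fun f => mem_sobolevSpace.2 ⟨f, besselPotential_neg_apply hk s _⟩

theorem besselPotential_sobolevOfL2 {k : ℝ} (hk : 0 < k) (s : ℝ)
    (f : Lp ℂ 2 (volume : Measure E)) :
    besselPotential k s (sobolevOfL2 hk s f : 𝓢'(E, ℂ)) = f :=
  besselPotential_neg_apply hk s _

/-- The Fourier multiplier operator from `Hˢ` to `Hʳ` with symbol
`b(ξ) (k² + |2πξ|²)^((s - r)/2)`, where `b` is bounded. -/
def sobolevMultiplier {k : ℝ} (hk : 0 < k) (s r : ℝ) (b : Lp ℂ ⊤ (volume : Measure E)) :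
    sobolevSpace E k s →ₗ[ℂ] sobolevSpace E k r :=
  sobolevOfL2 hk r ∘ₗ (Lp.fourierTransformₗᵢ E ℂ).symm.toLinearEquiv.toLinearMap ∘ₗ
    ((ContinuousLinearMap.lsmul ℂ ℂ).holderₗ volume ⊤ 2 2 b) ∘ₗ
    (Lp.fourierTransformₗᵢ E ℂ).toLinearEquiv.toLinearMap ∘ₗ sobolevToL2 k s

theorem besselPotential_sobolevMultiplier {k : ℝ} (hk : 0 < k) (s r : ℝ)
    (b : Lp ℂ ⊤ (volume : Measure E)) (u : sobolevSpace E k s) :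
    besselPotential k r (sobolevMultiplier hk s r b u : 𝓢'(E, ℂ)) =
      (𝓕⁻ (b • 𝓕 (sobolevToL2 k s u) : Lp ℂ 2 (volume : Measure E)) :
        Lp ℂ 2 (volume : Measure E)) :=
  besselPotential_sobolevOfL2 hk r _

theorem sobolevNorm_sobolevMultiplier_le {k : ℝ} (hk : 0 < k) (s r : ℝ)
    (b : Lp ℂ ⊤ (volume : Measure E)) (u : sobolevSpace E k s) :
    sobolevNorm (sobolevMultiplier hk s r b u) ≤ ‖b‖ * sobolevNorm u := by
  rw [sobolevNorm_eq _ _ (besselPotential_sobolevMultiplier hk s r b u),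
    sobolevNorm_eq _ _ (besselPotential_eq_sobolevToL2 u), ← Lp.norm_fourier_eq,
    FourierTransform.fourier_fourierInv_eq, ← Lp.norm_fourier_eq (sobolevToL2 k s u)]
  exact Lp.norm_smul_le _ _

theorem sobolevMultiplier_apply_apply {k : ℝ} (hk : 0 < k) (s r : ℝ)
    (b : Lp ℂ ⊤ (volume : Measure E)) (u : sobolevSpace E k s) (g : 𝓢(E, ℂ)) :
    (sobolevMultiplier hk s r b u : 𝓢'(E, ℂ)) g =
      ∫ ξ, besselSymbol k (-r) ξ * (𝓕⁻ g) ξ *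
        (b ξ * (𝓕 (sobolevToL2 k s u) : Lp ℂ 2 (volume : Measure E)) ξ) := by
  rw [apply_eq_integral_of_besselPotential_eq hk (besselPotential_sobolevMultiplier hk s r b u) g,
    FourierTransform.fourier_fourierInv_eq]
  refine integral_congr_ae ?_
  filter_upwards [Lp.coeFn_lpSMul (r := 2) b
    (𝓕 (sobolevToL2 k s u) : Lp ℂ 2 (volume : Measure E))] with ξ hξ
  rw [hξ]
  rfl

end FourierSide

/-! ### The trace of a regularized convolution operator -/

section Convolution

variable {E : Type*} [NormedAddCommGroup E] [InnerProductSpace ℝ E] [FiniteDimensional ℝ E]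
  [MeasurableSpace E] [BorelSpace E]

theorem integral_mul_fourierInv {V W : E → ℂ} (hV : Integrable V) (hW : Integrable W) :
    ∫ x, V x * 𝓕⁻ W x = ∫ ξ, 𝓕⁻ V ξ * W ξ := by
  have h := VectorFourier.integral_fourierIntegral_smul_eq_flip (L := -innerₗ E)
    Real.continuous_fourierChar
    (by
      have : Continuous fun p : E × E => -(inner ℝ p.1 p.2) := by fun_prop
      exact this) hV hW
  have hL : (-innerₗ E).flip = -innerₗ E := by
    ext x y
    simp [real_inner_comm]
  rw [hL] at h
  exact h.symm

theorem fourierInv_sub_left (g : E → ℂ) (x ξ : E) :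
    𝓕⁻ (fun y => g (x - y)) ξ = (Real.fourierChar (inner ℝ ξ x) : ℂ) * 𝓕 g ξ := by
  rw [Real.fourierInv_eq, Real.fourier_eq, ← integral_const_mul,
    ← integral_sub_left_eq_self (fun y => (Real.fourierChar (inner ℝ ξ x) : ℂ) *
      Real.fourierChar (-inner ℝ y ξ) • g y) volume x]
  refine integral_congr_ae (Eventually.of_forall fun y => ?_)
  simp only [Circle.smul_def, smul_eq_mul, ← mul_assoc, ← Circle.coe_mul, ← AddChar.map_add_eq_mul]
  congr 4
  rw [inner_sub_left]
  linarith [real_inner_comm x ξ]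

theorem norm_fourier_le_of_norm_le {g : E → ℂ} {R : E → ℝ} (hR : Integrable R)
    (hg : ∀ᵐ z, ‖g z‖ ≤ R z) (ξ : E) : ‖𝓕 g ξ‖ ≤ ∫ z, R z := by
  rw [Real.fourier_eq]
  refine norm_integral_le_of_norm_le hR ?_
  filter_upwards [hg] with z hz
  rwa [Circle.norm_smul]

theorem continuous_fourier {g : E → ℂ} (hg : Integrable g) : Continuous (𝓕 g) :=
  VectorFourier.fourierIntegral_continuous Real.continuous_fourierChar
    (by exact continuous_inner) hg

theorem tendsto_fourier {G : ℝ → E → ℂ} {R : E → ℝ} (hR : Integrable R)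
    (hGm : ∀ t ≠ 0, AEStronglyMeasurable (G t)) (hGR : ∀ t ≠ 0, ∀ᵐ z, ‖G t z‖ ≤ R z)
    (hlim : ∀ᵐ z, Tendsto (fun t => G t z) (𝓝[≠] 0) (𝓝 (G 0 z))) (ξ : E) :
    Tendsto (fun t => 𝓕 (G t) ξ) (𝓝[≠] 0) (𝓝 (𝓕 (G 0) ξ)) := by
  simp_rw [Real.fourier_eq]
  have hc : Continuous fun z : E => Real.fourierChar (-inner ℝ z ξ) := by
    exact Real.continuous_fourierChar.comp (by fun_prop)
  refine tendsto_integral_filter_of_dominated_convergence R ?_ ?_ hR ?_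
  · filter_upwards [self_mem_nhdsWithin] with t ht
    exact hc.aestronglyMeasurable.smul (hGm t ht)
  · filter_upwards [self_mem_nhdsWithin] with t ht
    filter_upwards [hGR t ht] with z hz
    rwa [Circle.norm_smul]
  · filter_upwards [hlim] with z hz
    exact hz.const_smul _

/-- Testing the convolution of a distribution `u ∈ Hˢ` with a test function `g` against a Schwartz
function `V`, on the Fourier side. -/
theorem integral_mul_apply_translate {k s : ℝ} (hk : 0 < k) (u : sobolevSpace E k s)
    {g : E → ℂ} (hg : HasCompactSupport g) (hg' : ContDiff ℝ (⊤ : ℕ∞) g) (T : E → 𝓢(E, ℂ))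
    (hT : ∀ x y, T x y = g (x - y)) (V : 𝓢(E, ℂ)) :
    ∫ x, V x * (u : 𝓢'(E, ℂ)) (T x) = ∫ ξ, besselSymbol k (-s) ξ * (𝓕⁻ V) ξ *
      (𝓕 g ξ * (𝓕 (sobolevToL2 k s u) : Lp ℂ 2 (volume : Measure E)) ξ) := by
  set F : Lp ℂ 2 (volume : Measure E) := 𝓕 (sobolevToL2 k s u) with hF
  set gS : 𝓢(E, ℂ) := hg.toSchwartzMap hg' with hgS
  have hgSg : (gS : E → ℂ) = g := rfl
  set W : E → ℂ := fun ξ => besselSymbol k (-s) ξ * 𝓕 g ξ * F ξ with hWdef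
  have hW : Integrable W := by
    have h1 := (SchwartzMap.smulLeftCLM ℂ (besselSymbol k (-s)) (𝓕 gS)).memLp 2
      (volume : Measure E)
    have h2 := h1.integrable_mul (Lp.memLp F)
    refine h2.congr (Eventually.of_forall fun ξ => ?_)
    simp only [Pi.mul_apply, hWdef,
      SchwartzMap.smulLeftCLM_apply_apply (hasTemperateGrowth_besselSymbol hk (-s)), smul_eq_mul,
      SchwartzMap.fourier_coe, hgSg]
  have h1 : ∀ x, (u : 𝓢'(E, ℂ)) (T x) = 𝓕⁻ W x := by
    intro x
    rw [apply_eq_integral_of_besselPotential_eq hk (besselPotential_eq_sobolevToL2 u),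
      Real.fourierInv_eq]
    refine integral_congr_ae (Eventually.of_forall fun ξ => ?_)
    have h2 : (T x : E → ℂ) = fun y => g (x - y) := funext (hT x)
    simp only [SchwartzMap.fourierInv_coe, h2, fourierInv_sub_left, hWdef, Circle.smul_def,
      smul_eq_mul]
    ring
  simp_rw [h1]
  rw [integral_mul_fourierInv V.integrable hW]
  refine integral_congr_ae (Eventually.of_forall fun ξ => ?_)
  simp only [hWdef, SchwartzMap.fourierInv_coe]
  ring

/-- If the kernels `G t` converge to `G 0` dominatedly, the convolutions of `u ∈ Hˢ` with `G t`
converge in the sense of distributions; here `F` is the Fourier transform of `𝒥ₖˢ u`. -/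
theorem tendsto_integral_fourier_mul {k s : ℝ} (hk : 0 < k) (F : Lp ℂ 2 (volume : Measure E))
    {G : ℝ → E → ℂ} {R : E → ℝ} (hR : Integrable R)
    (hGm : ∀ t ≠ 0, AEStronglyMeasurable (G t)) (hGR : ∀ t ≠ 0, ∀ᵐ z, ‖G t z‖ ≤ R z)
    (hlim : ∀ᵐ z, Tendsto (fun t => G t z) (𝓝[≠] 0) (𝓝 (G 0 z))) (V : 𝓢(E, ℂ)) :
    Tendsto (fun t => ∫ ξ, besselSymbol k (-s) ξ * (𝓕⁻ V) ξ * (𝓕 (G t) ξ * F ξ)) (𝓝[≠] 0)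
      (𝓝 (∫ ξ, besselSymbol k (-s) ξ * (𝓕⁻ V) ξ * (𝓕 (G 0) ξ * F ξ))) := by
  have h1 := (SchwartzMap.smulLeftCLM ℂ (besselSymbol k (-s)) (𝓕⁻ V)).memLp 2
    (volume : Measure E)
  have h2 : Integrable fun ξ => besselSymbol k (-s) ξ * (𝓕⁻ V) ξ * F ξ := by
    have h3 := h1.integrable_mul (Lp.memLp F)
    refine h3.congr (Eventually.of_forall fun ξ => ?_)
    simp only [Pi.mul_apply,
      SchwartzMap.smulLeftCLM_apply_apply (hasTemperateGrowth_besselSymbol hk (-s)), smul_eq_mul]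
  have h4 : Integrable fun ξ => (∫ z, R z) * ‖besselSymbol k (-s) ξ * (𝓕⁻ V) ξ * F ξ‖ :=
    h2.norm.const_mul _
  refine tendsto_integral_filter_of_dominated_convergence _ ?_ ?_ h4 ?_
  · filter_upwards [self_mem_nhdsWithin] with t ht
    have hc : Continuous (𝓕 (G t)) := continuous_fourier (hR.mono' (hGm t ht) (hGR t ht))
    exact ((continuous_besselSymbol hk _).mul (𝓕⁻ V).continuous).aestronglyMeasurable.mul
      (hc.aestronglyMeasurable.mul (Lp.aestronglyMeasurable F))
  · filter_upwards [self_mem_nhdsWithin] with t ht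
    refine Eventually.of_forall fun ξ => ?_
    have h3 := norm_fourier_le_of_norm_le hR (hGR t ht) ξ
    rw [mul_left_comm, norm_mul]
    gcongr
  · refine Eventually.of_forall fun ξ => ?_
    exact ((tendsto_fourier hR hGm hGR hlim ξ).mul_const _).const_mul _

end Convolution

theorem testToSchwartz_apply {E : Type*} [NormedAddCommGroup E] [InnerProductSpace ℝ E]
    {Ω : Opens E} (v : 𝓓(Ω, ℝ)) (x : E) : testToSchwartz v x = (v x : ℂ) := rfl

/-- The boundary integral operator exists, with the expected norm bound, as soon as the fundamental
solution agrees near the screen with an approximate convolution kernel whose symbol is bounded by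
that of a Bessel potential of order `-1`. -/
theorem exists_singleLayer_operator {d : ℕ} {k : ℝ} (hk : 0 < k) (s : ℝ)
    (Γ : Opens (EuclideanSpace ℝ (Fin d))) (G : ℝ → EuclideanSpace ℝ (Fin d) → ℂ)
    (R : EuclideanSpace ℝ (Fin d) → ℝ) (B : ℝ)
    (hsm : ∀ t ≠ 0, ContDiff ℝ (⊤ : ℕ∞) (G t)) (hcs : ∀ t ≠ 0, HasCompactSupport (G t))
    (hΦ : ∀ t ≠ 0, ∀ x ∈ Γ, ∀ᶠ y in 𝓝ˢ (closure (Γ : Set (EuclideanSpace ℝ (Fin d)))),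
      G t (x - y) = fundamentalSolution k (point x t) (point y 0))
    (hR : Integrable R) (hGR : ∀ t, ∀ᵐ z, ‖G t z‖ ≤ R z)
    (hlim : ∀ᵐ z, Tendsto (fun t => G t z) (𝓝[≠] 0) (𝓝 (G 0 z)))
    (hB : ∀ ξ, ‖𝓕 (G 0) ξ * besselSymbol k 1 ξ‖ ≤ B) :
    ∃ S : sobolevSupportedIn k s (closure (Γ : Set (EuclideanSpace ℝ (Fin d)))) →ₗ[ℂ]
        sobolevOn k (s + 1) Γ,
      (∀ φ, IsSingleLayerTrace k Γ φ.1.1 (S φ).1) ∧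
        ∀ φ, sobolevOnNorm (S φ) ≤ B * sobolevNorm φ.1 := by
  have hB0 : 0 ≤ B := (norm_nonneg _).trans (hB 0)
  have hGm : ∀ t ≠ 0, AEStronglyMeasurable (G t) := fun t ht =>
    (hsm t ht).continuous.aestronglyMeasurable
  have hG0 : AEStronglyMeasurable (G 0) := by
    refine aestronglyMeasurable_of_tendsto_ae atTop
      (f := fun n : ℕ => G (1 / ((n : ℝ) + 1))) (fun n => hGm _ (by positivity)) ?_
    filter_upwards [hlim] with z hz
    exact hz.comp (tendsto_nhdsWithin_iff.2 ⟨tendsto_one_div_add_atTop_nhds_zero_nat,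
      Eventually.of_forall fun n => (by positivity : (1 / ((n : ℝ) + 1)) ≠ 0)⟩)
  have hbc : Continuous fun ξ => 𝓕 (G 0) ξ * besselSymbol k 1 ξ :=
    (continuous_fourier (hR.mono' hG0 (hGR 0))).mul (continuous_besselSymbol hk 1)
  have hbL : MemLp (fun ξ => 𝓕 (G 0) ξ * besselSymbol k 1 ξ) ⊤ volume :=
    memLp_top_of_bound hbc.aestronglyMeasurable B (Eventually.of_forall hB)
  set b : Lp ℂ ⊤ (volume : Measure (EuclideanSpace ℝ (Fin d))) := hbL.toLp with hb
  have hbn : ‖b‖ ≤ B := by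
    rw [hb, Lp.norm_toLp]
    refine ENNReal.toReal_le_of_le_ofReal hB0 ?_
    rw [eLpNorm_exponent_top]
    exact eLpNormEssSup_le_of_ae_bound (Eventually.of_forall hB)
  refine ⟨((restrict Γ).submoduleMap (sobolevSpace _ k (s + 1))) ∘ₗ
    sobolevMultiplier hk s (s + 1) b ∘ₗ Submodule.subtype _, fun φ => ?_, fun φ => ?_⟩
  · intro v
    set V : 𝓢(EuclideanSpace ℝ (Fin d), ℂ) := testToSchwartz v with hV
    set F : Lp ℂ 2 (volume : Measure (EuclideanSpace ℝ (Fin d))) := 𝓕 (sobolevToL2 k s φ.1)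
    have h0 := tendsto_integral_fourier_mul (s := s) hk F hR hGm (fun t _ => hGR t) hlim V
    have h1 : (sobolevMultiplier hk s (s + 1) b φ.1 : 𝓢'(EuclideanSpace ℝ (Fin d), ℂ)) V =
        ∫ ξ, besselSymbol k (-s) ξ * (𝓕⁻ V) ξ * (𝓕 (G 0) ξ * F ξ) := by
      rw [sobolevMultiplier_apply_apply]
      refine integral_congr_ae ?_
      filter_upwards [hbL.coeFn_toLp] with ξ hξ
      rw [hξ, show (-s) = -(s + 1) + 1 by ring, besselSymbol_add hk]
      ring
    rw [← h1] at h0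
    have h2 : ∀ t ≠ 0, ∫ x, (v x : ℂ) * singleLayerPotential k Γ φ.1.1 (point x t) =
        ∫ ξ, besselSymbol k (-s) ξ * (𝓕⁻ V) ξ * (𝓕 (G t) ξ * F ξ) := by
      intro t ht
      have hsub : ∀ x, ContDiff ℝ (⊤ : ℕ∞) fun y => G t (x - y) := fun x =>
        (hsm t ht).comp (contDiff_const.sub contDiff_id)
      have hcsub : ∀ x, HasCompactSupport fun y => G t (x - y) := fun x =>
        (hcs t ht).comp_homeomorph (Homeomorph.subLeft x)
      rw [← integral_mul_apply_translate hk φ.1 (hcs t ht) (hsm t ht)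
        (fun x => (hcsub x).toSchwartzMap (hsub x)) (fun x y => rfl) V]
      refine integral_congr_ae (Eventually.of_forall fun x => ?_)
      simp only [hV, testToSchwartz_apply]
      by_cases hx : x ∈ Γ
      · rw [singleLayerPotential_eq φ.2 (f := (hcsub x).toSchwartzMap (hsub x)) (hΦ t ht x hx)]
      · have hvx : v x = 0 := by
          by_contra hne
          exact hx (v.tsupport_subset (subset_tsupport _ hne))
        simp [hvx]
    have h3 : Tendsto (fun t : ℝ => ∫ x, (v x : ℂ) * singleLayerPotential k Γ φ.1.1 (point x t))
        (𝓝[≠] 0) (𝓝 ((sobolevMultiplier hk s (s + 1) b φ.1 :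
          𝓢'(EuclideanSpace ℝ (Fin d), ℂ)) V)) := by
      refine h0.congr' ?_
      filter_upwards [self_mem_nhdsWithin] with t ht
      exact (h2 t ht).symm
    exact ⟨h3.mono_left (nhdsWithin_mono _ fun t ht => ne_of_gt ht),
      h3.mono_left (nhdsWithin_mono _ fun t ht => ne_of_lt ht)⟩
  · refine le_trans (b := sobolevNorm (sobolevMultiplier hk s (s + 1) b φ.1)) ?_
      ((sobolevNorm_sobolevMultiplier_le hk s (s + 1) b φ.1).trans ?_)
    · refine csInf_le ⟨0, ?_⟩ ⟨sobolevMultiplier hk s (s + 1) b φ.1, rfl, rfl⟩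
      rintro r ⟨U, -, rfl⟩
      exact norm_nonneg _
    · exact mul_le_mul_of_nonneg_right hbn (norm_nonneg _)

/-! ### Fourier transforms of radial functions on the line and in the plane -/

theorem fourierChar_eq_exp (x : ℝ) :
    (Real.fourierChar (-x) : ℂ) = Complex.exp (-(Complex.I * (2 * Real.pi * x : ℝ))) := by
  rw [Real.fourierChar_apply]
  congr 1
  push_cast
  ring

theorem fourier_radial_complex (g : ℝ → ℂ)
    (hg : IntegrableOn (fun r => r * g r) (Set.Ioi 0)) (w : ℂ) :
    𝓕 (fun z : ℂ => g ‖z‖) w =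
      ∫ r in Set.Ioi (0 : ℝ), r * g r * waveAverage (2 * Real.pi * ‖w‖ * r) := by
  -- by rotation invariance, `w` may be taken on the positive real axis
  have hw : 𝓕 (fun z : ℂ => g ‖z‖) w = 𝓕 (fun z : ℂ => g ‖z‖) (‖w‖ : ℂ) := by
    rcases eq_or_ne w 0 with rfl | h0
    · simp
    have hn : (‖w‖ : ℂ) ≠ 0 := by exact_mod_cast (norm_pos_iff.2 h0).ne'
    set c : Circle := ⟨w / ‖w‖, by
      change _ ∈ Metric.sphere (0 : ℂ) 1
      rw [mem_sphere_zero_iff_norm, norm_div, Complex.norm_real, norm_norm,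
        div_self (norm_pos_iff.2 h0).ne']⟩ with hc
    have h1 := Real.fourier_comp_linearIsometry (rotation c) (fun z : ℂ => g ‖z‖) (‖w‖ : ℂ)
    have h2 : rotation c (‖w‖ : ℂ) = w := by
      rw [rotation_apply, hc]
      simp only
      field_simp
    have h3 : (fun z : ℂ => g ‖z‖) ∘ rotation c = fun z : ℂ => g ‖z‖ := by
      ext z
      simp only [Function.comp, LinearIsometryEquiv.norm_map]
    rw [h2, h3] at h1
    exact h1.symm
  set a : ℝ := 2 * Real.pi * ‖w‖ with ha
  have hbd : IntegrableOn (fun p : ℝ × ℝ => p.1 * g p.1 *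
      Complex.exp (-(Complex.I * (a * p.1 * Real.cos p.2 : ℝ))))
      (Set.Ioi 0 ×ˢ Set.Ioo (-Real.pi) Real.pi) (volume.prod volume) := by
    have h1 : Integrable (fun p : ℝ × ℝ => p.1 * g p.1 * (1 : ℂ))
        ((volume.restrict (Set.Ioi 0)).prod (volume.restrict (Set.Ioo (-Real.pi) Real.pi))) :=
      Integrable.mul_prod (f := fun r : ℝ => (r : ℂ) * g r) (g := fun _ => (1 : ℂ)) hg
        (integrable_const _)
    rw [IntegrableOn, ← Measure.prod_restrict]
    have hc : Continuous fun p : ℝ × ℝ =>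
        Complex.exp (-(Complex.I * (a * p.1 * Real.cos p.2 : ℝ))) := by fun_prop
    have h2 := h1.bdd_mul (c := 1) hc.aestronglyMeasurable (Eventually.of_forall fun p => by
      rw [norm_exp_neg_I_mul_ofReal])
    refine h2.congr (Eventually.of_forall fun p => ?_)
    simp only
    ring
  rw [hw, Real.fourier_eq, ← Complex.integral_comp_polarCoord_symm, polarCoord_target]
  have h4 : ∀ p ∈ Set.Ioi (0 : ℝ) ×ˢ Set.Ioo (-Real.pi) Real.pi,
      p.1 • (Real.fourierChar (-inner ℝ (Complex.polarCoord.symm p) (‖w‖ : ℂ)) •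
        g ‖Complex.polarCoord.symm p‖) =
      p.1 * g p.1 * Complex.exp (-(Complex.I * (a * p.1 * Real.cos p.2 : ℝ))) := by
    rintro ⟨r, θ⟩ ⟨hr, -⟩
    have hr : 0 < r := hr
    have h5 : ‖Complex.polarCoord.symm (r, θ)‖ = r := by
      rw [Complex.norm_polarCoord_symm, abs_of_pos hr]
    have h6 : inner ℝ (Complex.polarCoord.symm (r, θ)) (‖w‖ : ℂ) = ‖w‖ * r * Real.cos θ := by
      rw [Complex.polarCoord_symm_apply, Complex.inner]
      simp
      rw [Complex.cos_ofReal_re]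
      ring
    rw [h5, h6, Circle.smul_def, smul_eq_mul, fourierChar_eq_exp, Complex.real_smul, ha]
    push_cast
    ring_nf
  rw [setIntegral_congr_fun (measurableSet_Ioi.prod measurableSet_Ioo) h4, Measure.volume_eq_prod,
    setIntegral_prod _ hbd]
  refine setIntegral_congr_fun measurableSet_Ioi fun r _ => ?_
  simp only
  rw [integral_const_mul, waveAverage, angularIntegral,
    intervalIntegral.integral_of_le (by linarith [Real.pi_pos]), integral_Ioc_eq_integral_Ioo]
  simp

theorem fourier_radial_plane (g : ℝ → ℂ)
    (hg : IntegrableOn (fun r => r * g r) (Set.Ioi 0)) (ξ : EuclideanSpace ℝ (Fin 2)) :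
    𝓕 (fun z : EuclideanSpace ℝ (Fin 2) => g ‖z‖) ξ =
      ∫ r in Set.Ioi (0 : ℝ), r * g r * waveAverage (2 * Real.pi * ‖ξ‖ * r) := by
  have h1 := Real.fourier_comp_linearIsometry Complex.orthonormalBasisOneI.repr
    (fun z : EuclideanSpace ℝ (Fin 2) => g ‖z‖) (Complex.orthonormalBasisOneI.repr.symm ξ)
  rw [LinearIsometryEquiv.apply_symm_apply] at h1
  have h3 : (fun z : EuclideanSpace ℝ (Fin 2) => g ‖z‖) ∘ Complex.orthonormalBasisOneI.repr =
      fun z : ℂ => g ‖z‖ := by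
    ext z
    simp only [Function.comp, LinearIsometryEquiv.norm_map]
  rw [h3] at h1
  rw [← h1, fourier_radial_complex g hg, LinearIsometryEquiv.norm_map]

theorem fourier_radial_real (g : ℝ → ℂ) (hg : IntegrableOn g (Set.Ioi 0)) (w : ℝ) :
    𝓕 (fun x : ℝ => g ‖x‖) w =
      ∫ r in Set.Ioi (0 : ℝ), 2 * (g r * Real.cos (2 * Real.pi * ‖w‖ * r)) := by
  set f : ℝ → ℂ := fun v => Complex.exp (-(Complex.I * (2 * Real.pi * (w * v) : ℝ))) * g |v|
    with hf
  have hcos : ∀ r, Real.cos (2 * Real.pi * ‖w‖ * r) = Real.cos (2 * Real.pi * (w * r)) := by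
    intro r
    rw [Real.norm_eq_abs]
    rcases abs_choice w with h | h <;> rw [h]
    · ring_nf
    · rw [← Real.cos_neg]; ring_nf
  have hc : ∀ s : ℝ, Continuous fun v : ℝ =>
      Complex.exp (-(Complex.I * (2 * Real.pi * (s * v) : ℝ))) := fun s => by fun_prop
  have hint : ∀ s : ℝ, IntegrableOn (fun v : ℝ =>
      Complex.exp (-(Complex.I * (2 * Real.pi * (s * v) : ℝ))) * g v) (Set.Ioi 0) := fun s =>
    Integrable.bdd_mul (c := 1) hg (hc s).aestronglyMeasurable
      (Eventually.of_forall fun p => by rw [norm_exp_neg_I_mul_ofReal])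
  have hpos : IntegrableOn f (Set.Ioi 0) := by
    refine (hint w).congr_fun (fun v hv => ?_) measurableSet_Ioi
    simp only [hf, abs_of_pos (show 0 < v from hv)]
  have hneg' : IntegrableOn (fun v => f (-v)) (Set.Ioi 0) := by
    refine (hint (-w)).congr_fun (fun v hv => ?_) measurableSet_Ioi
    simp only [hf, abs_neg, abs_of_pos (show 0 < v from hv)]
    ring_nf
  have hneg : IntegrableOn f (Set.Iic 0) := by
    rw [integrableOn_Iic_iff_integrableOn_Iio]
    have := hneg'.comp_neg
    simpa using this
  have h1 : 𝓕 (fun x : ℝ => g ‖x‖) w = ∫ v, f v := by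
    rw [Real.fourier_eq]
    refine integral_congr_ae (Eventually.of_forall fun v => ?_)
    simp only [hf, Circle.smul_def, smul_eq_mul, fourierChar_eq_exp, Real.norm_eq_abs]
    simp [mul_comm]
  have h2 : ∫ v in Set.Iic 0, f v = ∫ v in Set.Ioi 0, f (-v) := by
    simp
  rw [h1, ← integral_add_compl measurableSet_Ioi (integrableOn_univ.1 (by
    rw [← Set.Iic_union_Ioi (a := (0 : ℝ))]; exact hneg.union hpos)), Set.compl_Ioi, h2,
    ← integral_add hpos hneg']
  refine setIntegral_congr_fun measurableSet_Ioi fun v hv => ?_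
  simp only [hf, abs_neg, abs_of_pos (show 0 < v from hv)]
  rw [hcos, Complex.ofReal_cos, Complex.cos]
  push_cast
  ring_nf

theorem fourier_radial_line (g : ℝ → ℂ) (hg : IntegrableOn g (Set.Ioi 0))
    (ξ : EuclideanSpace ℝ (Fin 1)) :
    𝓕 (fun z : EuclideanSpace ℝ (Fin 1) => g ‖z‖) ξ =
      ∫ r in Set.Ioi (0 : ℝ), 2 * (g r * Real.cos (2 * Real.pi * ‖ξ‖ * r)) := by
  set A : ℝ ≃ₗᵢ[ℝ] EuclideanSpace ℝ (Fin 1) := (OrthonormalBasis.singleton (Fin 1) ℝ).repr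
  have h1 := Real.fourier_comp_linearIsometry A
    (fun z : EuclideanSpace ℝ (Fin 1) => g ‖z‖) (A.symm ξ)
  rw [LinearIsometryEquiv.apply_symm_apply] at h1
  have h3 : (fun z : EuclideanSpace ℝ (Fin 1) => g ‖z‖) ∘ A = fun z : ℝ => g ‖z‖ := by
    ext z
    simp only [Function.comp, LinearIsometryEquiv.norm_map]
  rw [h3] at h1
  rw [← h1, fourier_radial_real g hg, LinearIsometryEquiv.norm_map]

theorem integral_radialCutoff_scale {L : ℝ} (hL : 0 < L) (h : ℝ → ℂ) :
    ∫ r in Set.Ioi (0 : ℝ), radialCutoff (r / L) * h r =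
      L * ∫ r in (0 : ℝ)..2, radialCutoff r * h (L * r) := by
  have h1 := integral_comp_mul_left_Ioi (fun r => (radialCutoff (r / L) : ℂ) * h r) 0 hL
  simp only [mul_zero, mul_div_cancel_left₀ _ hL.ne'] at h1
  have h2 : ∫ r in Set.Ioi (0 : ℝ), (radialCutoff r : ℂ) * h (L * r) =
      ∫ r in (0 : ℝ)..2, radialCutoff r * h (L * r) := by
    rw [intervalIntegral.integral_of_le zero_le_two]
    refine setIntegral_eq_of_subset_of_forall_sdiff_eq_zero measurableSet_Ioi
      (fun r hr => hr.1) fun r hr => ?_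
    have : 2 ≤ r := by
      by_contra hlt
      exact hr.2 ⟨hr.1, (not_le.1 hlt).le⟩
    rw [radialCutoff_eq_zero this, Complex.ofReal_zero, zero_mul]
  rw [← h2, h1, Complex.real_smul, ← mul_assoc, ← Complex.ofReal_mul, mul_inv_cancel₀ hL.ne',
    Complex.ofReal_one, one_mul]

/-! ### The truncated fundamental solution -/

/-- The fundamental solution in `ℝᵈ⁺¹` as a function of the distance of its arguments. -/
def kernelProfile (d : ℕ) (k ρ : ℝ) : ℂ :=
  if d = 2 then Complex.exp (Complex.I * (k * ρ : ℝ)) / (4 * Real.pi * ρ : ℝ)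
  else Complex.I / 4 * hankelH0 (k * ρ)

theorem norm_point_sub_point {d : ℕ} (x y : EuclideanSpace ℝ (Fin d)) (t : ℝ) :
    ‖point x t - point y 0‖ = √(‖x - y‖ ^ 2 + t ^ 2) := by
  rw [EuclideanSpace.norm_eq, EuclideanSpace.norm_sq_eq]
  congr 1
  rw [Fin.sum_univ_castSucc]
  simp [point]

theorem fundamentalSolution_point {d : ℕ} (k t : ℝ) (x y : EuclideanSpace ℝ (Fin d)) :
    fundamentalSolution k (point x t) (point y 0) =
      kernelProfile d k (√(‖x - y‖ ^ 2 + t ^ 2)) := by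
  rw [fundamentalSolution, kernelProfile, norm_point_sub_point]
  simp

theorem contDiffOn_kernelProfile (d : ℕ) {k : ℝ} (hk : 0 < k) :
    ContDiffOn ℝ (⊤ : ℕ∞) (kernelProfile d k) (Set.Ioi 0) := by
  refine contDiffOn_infty.2 fun n => ?_
  by_cases hd : d = 2
  · have : kernelProfile d k = fun ρ =>
        Complex.exp (Complex.I * (k * ρ : ℝ)) / (4 * Real.pi * ρ : ℝ) := by
      ext ρ; rw [kernelProfile, if_pos hd]
    rw [this]
    have h1 : ContDiff ℝ n fun ρ : ℝ => ((k * ρ : ℝ) : ℂ) :=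
      Complex.ofRealCLM.contDiff.comp (contDiff_const.mul contDiff_id)
    have h2 : ContDiff ℝ n fun ρ : ℝ => ((4 * Real.pi * ρ : ℝ) : ℂ) :=
      Complex.ofRealCLM.contDiff.comp (contDiff_const.mul contDiff_id)
    simp_rw [div_eq_mul_inv]
    refine (contDiff_const.mul h1).cexp.contDiffOn.mul (h2.contDiffOn.inv fun ρ hρ => ?_)
    have hρ : 0 < ρ := hρ
    exact_mod_cast (by positivity : 4 * Real.pi * ρ ≠ 0)
  · have : kernelProfile d k = fun ρ => Complex.I / 4 * hankelH0 (k * ρ) := by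
      ext ρ; rw [kernelProfile, if_neg hd]
    rw [this]
    exact contDiffOn_const.mul ((contDiffOn_hankelH0 n).comp (by fun_prop)
      fun ρ hρ => mul_pos hk hρ)

/-- The constant depends on `k`; the bound serves for integrability and dominated convergence
only. -/
theorem exists_norm_kernelProfile_le {d : ℕ} (hd : d = 1 ∨ d = 2) {k : ℝ} (hk : 0 < k) :
    ∃ C : ℝ, 0 ≤ C ∧ ∀ ρ > 0, ‖kernelProfile d k ρ‖ ≤ C * ρ ^ (-((d : ℝ) / 2)) := by
  rcases hd with rfl | rfl
  · obtain ⟨B, hB0, hB⟩ := exists_norm_hankelH0_le_rpow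
    refine ⟨B * k ^ (-(1 / 2) : ℝ), by positivity, fun ρ hρ => ?_⟩
    rw [kernelProfile, if_neg (by norm_num), norm_mul]
    have h1 := hB (k * ρ) (mul_pos hk hρ)
    rw [Real.mul_rpow hk.le hρ.le] at h1
    have h2 : ‖Complex.I / 4‖ ≤ 1 := by norm_num
    calc _ ≤ 1 * (B * (k ^ (-(1 / 2) : ℝ) * ρ ^ (-(1 / 2) : ℝ))) := by gcongr
      _ = _ := by push_cast; ring
  · refine ⟨1, zero_le_one, fun ρ hρ => ?_⟩
    rw [kernelProfile, if_pos rfl, norm_div, norm_exp_I_mul_ofReal, Complex.norm_real,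
      Real.norm_eq_abs, abs_of_pos (by positivity)]
    norm_num
    rw [Real.rpow_neg_one]
    have : 1 ≤ Real.pi * 4 := by linarith [Real.pi_gt_three]
    have h1 : ρ⁻¹ * (Real.pi⁻¹ * (1 / 4)) ≤ ρ⁻¹ * 1 := by
      gcongr
      rw [← div_eq_inv_mul, div_le_one Real.pi_pos]
      linarith [Real.pi_gt_three]
    linarith

/-- The fundamental solution between the hyperplanes at heights `t` and `0`, as a convolution kernel
on `ℝᵈ`, truncated at distances exceeding the diameter `L` of the screen. The truncation depends on
the distance in `ℝᵈ` only, not on `t`, and starts at `√2 L`, so that the kernel is unchanged in a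
neighbourhood of the closed screen. -/
def truncatedKernel (d : ℕ) (k L t : ℝ) (z : EuclideanSpace ℝ (Fin d)) : ℂ :=
  (cutoff (‖z‖ ^ 2 / L ^ 2) : ℂ) * kernelProfile d k (√(‖z‖ ^ 2 + t ^ 2))

theorem contDiff_truncatedKernel (d : ℕ) {k : ℝ} (hk : 0 < k) (L : ℝ) {t : ℝ} (ht : t ≠ 0) :
    ContDiff ℝ (⊤ : ℕ∞) (truncatedKernel d k L t) := by
  have h1 : ContDiff ℝ (⊤ : ℕ∞) fun z : EuclideanSpace ℝ (Fin d) =>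
      (cutoff (‖z‖ ^ 2 / L ^ 2) : ℂ) :=
    Complex.ofRealCLM.contDiff.comp (cutoff.contDiff.comp ((contDiff_norm_sq ℝ).div_const _))
  have h2 : ContDiff ℝ (⊤ : ℕ∞) fun z : EuclideanSpace ℝ (Fin d) => √(‖z‖ ^ 2 + t ^ 2) :=
    ContDiff.sqrt ((contDiff_norm_sq ℝ).add contDiff_const) fun z => by positivity
  exact h1.mul ((contDiffOn_kernelProfile d hk).comp_contDiff h2
    fun z => Real.sqrt_pos.2 (by positivity))

theorem truncatedKernel_eq_zero {d : ℕ} {k L t : ℝ} (hL : 0 < L) {z : EuclideanSpace ℝ (Fin d)}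
    (hz : 2 * L < ‖z‖) : truncatedKernel d k L t z = 0 := by
  have h : 3 ≤ |‖z‖ ^ 2 / L ^ 2| := by
    rw [abs_of_nonneg (by positivity), le_div_iff₀ (by positivity)]
    nlinarith
  rw [truncatedKernel, cutoff_eq_zero h, Complex.ofReal_zero, zero_mul]

theorem hasCompactSupport_truncatedKernel (d : ℕ) (k : ℝ) {L : ℝ} (hL : 0 < L) (t : ℝ) :
    HasCompactSupport (truncatedKernel d k L t) := by
  refine HasCompactSupport.intro (isCompact_closedBall 0 (2 * L)) fun z hz => ?_
  refine truncatedKernel_eq_zero hL ?_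
  simpa using hz

theorem truncatedKernel_eq_fundamentalSolution {d : ℕ} (k t : ℝ) {L : ℝ} (hL : 0 < L)
    {x y : EuclideanSpace ℝ (Fin d)} (hxy : ‖x - y‖ ^ 2 < 2 * L ^ 2) :
    truncatedKernel d k L t (x - y) = fundamentalSolution k (point x t) (point y 0) := by
  have h : |‖x - y‖ ^ 2 / L ^ 2| ≤ 2 := by
    rw [abs_of_nonneg (by positivity), div_le_iff₀ (by positivity)]
    exact hxy.le
  rw [truncatedKernel, cutoff_eq_one h, Complex.ofReal_one, one_mul, fundamentalSolution_point]

theorem exists_integrable_bound_truncatedKernel {d : ℕ} (hd : d = 1 ∨ d = 2) {k L : ℝ} (hk : 0 < k)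
    (hL : 0 < L) : ∃ R : EuclideanSpace ℝ (Fin d) → ℝ, Integrable R ∧
      ∀ t, ∀ᵐ z, ‖truncatedKernel d k L t z‖ ≤ R z := by
  obtain ⟨C, hC0, hC⟩ := exists_norm_kernelProfile_le hd hk
  have hd1 : 1 ≤ d := by omega
  have : Nontrivial (EuclideanSpace ℝ (Fin d)) := by
    refine Module.nontrivial_of_finrank_pos (R := ℝ) ?_
    rw [finrank_euclideanSpace_fin]
    omega
  refine ⟨fun z => (Set.Iic (2 * L)).indicator (fun r => C * r ^ (-((d : ℝ) / 2))) ‖z‖, ?_,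
    fun t => ?_⟩
  · rw [integrable_fun_norm_addHaar, finrank_euclideanSpace_fin]
    have h1 : IntegrableOn (fun r : ℝ => C * r ^ ((d : ℝ) / 2 - 1)) (Set.Ioc 0 (2 * L)) := by
      rw [← intervalIntegrable_iff_integrableOn_Ioc_of_le (by positivity)]
      refine (intervalIntegral.intervalIntegrable_rpow' ?_).const_mul C
      have : (1 : ℝ) ≤ d := by exact_mod_cast hd1
      linarith
    have h2 : IntegrableOn ((Set.Ioc 0 (2 * L)).indicator
        fun r : ℝ => C * r ^ ((d : ℝ) / 2 - 1)) (Set.Ioi 0) :=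
      ((integrable_indicator_iff measurableSet_Ioc).2 h1).integrableOn
    refine h2.congr_fun (fun r hr => ?_) measurableSet_Ioi
    have hr : 0 < r := hr
    by_cases h : r ≤ 2 * L
    · rw [Set.indicator_of_mem (show r ∈ Set.Ioc 0 (2 * L) from ⟨hr, h⟩),
        Set.indicator_of_mem (show r ∈ Set.Iic (2 * L) from h), smul_eq_mul, ← Real.rpow_natCast,
        mul_left_comm, ← Real.rpow_add hr, Nat.cast_sub hd1]
      congr 2
      push_cast
      ring
    · rw [Set.indicator_of_notMem (show r ∉ Set.Ioc 0 (2 * L) from fun h' => h h'.2),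
        Set.indicator_of_notMem (show r ∉ Set.Iic (2 * L) from h), smul_zero]
  · filter_upwards [Measure.ae_ne volume (0 : EuclideanSpace ℝ (Fin d))] with z hz
    have hz0 : 0 < ‖z‖ := norm_pos_iff.2 hz
    by_cases h : ‖z‖ ≤ 2 * L
    · rw [Set.indicator_of_mem (show ‖z‖ ∈ Set.Iic (2 * L) from h), truncatedKernel, norm_mul,
        Complex.norm_real, Real.norm_eq_abs, abs_of_nonneg cutoff.nonneg]
      have h1 : ‖z‖ ≤ √(‖z‖ ^ 2 + t ^ 2) := Real.le_sqrt_of_sq_le (by nlinarith [sq_nonneg t])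
      have h2 := hC _ (hz0.trans_le h1)
      calc _ ≤ 1 * (C * (√(‖z‖ ^ 2 + t ^ 2)) ^ (-((d : ℝ) / 2))) := by
            gcongr
            exact cutoff.le_one
        _ ≤ C * ‖z‖ ^ (-((d : ℝ) / 2)) := by
            rw [one_mul]
            gcongr C * ?_
            refine Real.rpow_le_rpow_of_nonpos hz0 h1 ?_
            have : (0 : ℝ) ≤ d := Nat.cast_nonneg d
            linarith
    · rw [truncatedKernel_eq_zero hL (not_le.1 h), norm_zero]
      rw [Set.indicator_of_notMem (show ‖z‖ ∉ Set.Iic (2 * L) from h)]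

theorem tendsto_truncatedKernel (d : ℕ) {k : ℝ} (hk : 0 < k) (L : ℝ)
    {z : EuclideanSpace ℝ (Fin d)} (hz : z ≠ 0) :
    Tendsto (fun t => truncatedKernel d k L t z) (𝓝[≠] 0) (𝓝 (truncatedKernel d k L 0 z)) := by
  have h1 : ContinuousAt (fun t : ℝ => √(‖z‖ ^ 2 + t ^ 2)) 0 := by fun_prop
  have h2 : ContinuousAt (kernelProfile d k) (√(‖z‖ ^ 2 + 0 ^ 2)) := by
    have h3 : 0 < √(‖z‖ ^ 2 + 0 ^ 2) := by
      have := norm_pos_iff.2 hz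
      positivity
    exact (contDiffOn_kernelProfile d hk).continuousOn.continuousAt (Ioi_mem_nhds h3)
  have h4 : ContinuousAt (fun t => truncatedKernel d k L t z) 0 :=
    continuousAt_const.mul (ContinuousAt.comp (f := fun t : ℝ => √(‖z‖ ^ 2 + t ^ 2)) h2 h1)
  exact h4.tendsto.mono_left nhdsWithin_le_nhds

/-! ### The symbol of the truncated single-layer operator -/

theorem truncatedKernel_zero_eq (d : ℕ) (k L : ℝ) : truncatedKernel d k L 0 =
    fun z => (fun r => (radialCutoff (r / L) : ℂ) * kernelProfile d k r) ‖z‖ := by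
  ext z
  simp [truncatedKernel, radialCutoff, div_pow]

theorem norm_besselSymbol_one_le {E : Type*} [NormedAddCommGroup E] {k : ℝ} (hk : 0 < k) (ξ : E) :
    ‖besselSymbol k 1 ξ‖ ≤ k + 2 * Real.pi * ‖ξ‖ := by
  have h0 : 0 ≤ 2 * Real.pi * ‖ξ‖ := by positivity
  rw [besselSymbol, Complex.norm_real, Real.norm_eq_abs, ← Real.sqrt_eq_rpow,
    abs_of_nonneg (Real.sqrt_nonneg _)]
  exact Real.sqrt_le_iff.2 ⟨by positivity, by nlinarith⟩

theorem integrableOn_radialCutoff_kernelProfile {d : ℕ} (hd : d = 1 ∨ d = 2) {k L : ℝ} (hk : 0 < k)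
    (hL : 0 < L) : IntegrableOn (fun r : ℝ => (r ^ (d - 1) : ℝ) •
      ((radialCutoff (r / L) : ℂ) * kernelProfile d k r)) (Set.Ioi 0) := by
  obtain ⟨R, hR, hGR⟩ := exists_integrable_bound_truncatedKernel hd hk hL
  have : Nontrivial (EuclideanSpace ℝ (Fin d)) := by
    refine Module.nontrivial_of_finrank_pos (R := ℝ) ?_
    rw [finrank_euclideanSpace_fin]
    omega
  have hm : AEStronglyMeasurable (truncatedKernel d k L 0) := by
    refine aestronglyMeasurable_of_tendsto_ae atTop
      (f := fun n : ℕ => truncatedKernel d k L (1 / ((n : ℝ) + 1))) (fun n =>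
        (contDiff_truncatedKernel d hk L (by positivity)).continuous.aestronglyMeasurable) ?_
    filter_upwards [Measure.ae_ne volume (0 : EuclideanSpace ℝ (Fin d))] with z hz
    exact (tendsto_truncatedKernel d hk L hz).comp
      (tendsto_nhdsWithin_iff.2 ⟨tendsto_one_div_add_atTop_nhds_zero_nat,
        Eventually.of_forall fun n => (by positivity : (1 / ((n : ℝ) + 1)) ≠ 0)⟩)
  have h1 := hR.mono' hm (hGR 0)
  rw [truncatedKernel_zero_eq] at h1
  have h2 := (integrable_fun_norm_addHaar volume
    (f := fun r => (radialCutoff (r / L) : ℂ) * kernelProfile d k r)).1 h1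
  rwa [finrank_euclideanSpace_fin] at h2

theorem mul_add_le_two_mul_of_bounds {n κ a M : ℝ} (hn : 0 ≤ n) (h1 : a ≤ κ → n * κ ≤ M)
    (h2 : κ ≤ a → n * a ≤ M) : n * (κ + a) ≤ 2 * M := by
  rcases le_total a κ with h | h
  · nlinarith [h1 h]
  · nlinarith [h2 h]

theorem exists_bound_symbol_plane : ∃ C : ℝ, 0 < C ∧ ∀ k L : ℝ, 0 < k → 0 < L →
    ∀ ξ : EuclideanSpace ℝ (Fin 2),
      ‖𝓕 (truncatedKernel 2 k L 0) ξ * besselSymbol k 1 ξ‖ ≤ C * boundFactor 2 (k * L) := by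
  obtain ⟨C₁, h₁, H₁⟩ := exists_bound_waveAverage_low
  obtain ⟨C₂, h₂, H₂⟩ := exists_bound_waveAverage_high
  refine ⟨2 * (C₁ + C₂) + 1, by positivity, fun k L hk hL ξ => ?_⟩
  have hκ : 0 < k * L := mul_pos hk hL
  set a : ℝ := 2 * Real.pi * ‖ξ‖ * L with ha
  have ha0 : 0 ≤ a := by positivity
  set I : ℂ := ∫ r in (0 : ℝ)..2, (radialCutoff r : ℂ) *
    Complex.exp (Complex.I * (k * L * r : ℝ)) * waveAverage (a * r) with hI
  have hF : 𝓕 (truncatedKernel 2 k L 0) ξ = (L : ℂ) * ((1 / (4 * Real.pi) : ℝ) * I) := by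
    have hg := integrableOn_radialCutoff_kernelProfile (d := 2) (Or.inr rfl) hk hL
    rw [truncatedKernel_zero_eq, fourier_radial_plane
      (fun r => (radialCutoff (r / L) : ℂ) * kernelProfile 2 k r) (by
      refine hg.congr_fun (fun r _ => ?_) measurableSet_Ioi
      simp)]
    have h1 : ∀ r ∈ Set.Ioi (0 : ℝ), (r : ℂ) * ((radialCutoff (r / L) : ℂ) * kernelProfile 2 k r) *
        waveAverage (2 * Real.pi * ‖ξ‖ * r) = radialCutoff (r / L) * ((1 / (4 * Real.pi) : ℝ) *
          (Complex.exp (Complex.I * (k * r : ℝ)) * waveAverage (2 * Real.pi * ‖ξ‖ * r))) := by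
      intro r hr
      have hr' : (r : ℂ) ≠ 0 := by exact_mod_cast (show (0 : ℝ) < r from hr).ne'
      have hpi : (Real.pi : ℂ) ≠ 0 := by exact_mod_cast Real.pi_ne_zero
      rw [kernelProfile, if_pos rfl]
      push_cast
      field_simp
    rw [setIntegral_congr_fun measurableSet_Ioi h1, integral_radialCutoff_scale hL, hI,
      ← intervalIntegral.integral_const_mul ((1 / (4 * Real.pi) : ℝ) : ℂ)]
    congr 1
    refine intervalIntegral.integral_congr fun r _ => ?_
    simp only [ha]
    ring_nf
  have hn : ‖I‖ * (k * L + a) ≤ 2 * ((C₁ + C₂) * (1 + √(k * L))) := by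
    have hs := Real.sqrt_nonneg (k * L)
    refine mul_add_le_two_mul_of_bounds (norm_nonneg _) (fun h => ?_) fun h => ?_
    · exact (H₁ (k * L) a hκ ha0 h).trans (by gcongr; linarith)
    · exact (H₂ (k * L) a hκ h).trans (by gcongr; linarith)
  have hpi : 1 / (4 * Real.pi) ≤ 1 := by
    rw [div_le_one (by positivity)]
    linarith [Real.pi_gt_three]
  rw [hF, norm_mul, norm_mul, norm_mul, Complex.norm_real, Complex.norm_real, Real.norm_eq_abs,
    Real.norm_eq_abs, abs_of_pos hL, abs_of_pos (by positivity), boundFactor, if_pos rfl,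
    ← Real.sqrt_eq_rpow]
  have hs := Real.sqrt_nonneg (k * L)
  calc L * (1 / (4 * Real.pi) * ‖I‖) * ‖besselSymbol k 1 ξ‖
      ≤ L * (1 * ‖I‖) * (k + 2 * Real.pi * ‖ξ‖) := by
        gcongr
        exact norm_besselSymbol_one_le hk ξ
    _ = ‖I‖ * (k * L + a) := by rw [ha]; ring
    _ ≤ _ := by nlinarith

theorem exists_bound_symbol_line : ∃ C : ℝ, 0 < C ∧ ∀ k L : ℝ, 0 < k → 0 < L →
    ∀ ξ : EuclideanSpace ℝ (Fin 1),
      ‖𝓕 (truncatedKernel 1 k L 0) ξ * besselSymbol k 1 ξ‖ ≤ C * boundFactor 1 (k * L) := by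
  obtain ⟨C₁, h₁, H₁⟩ := exists_bound_hankelH0_low
  obtain ⟨C₂, h₂, H₂⟩ := exists_bound_hankelH0_high
  refine ⟨2 * (2 * C₁ + C₂) + 1, by positivity, fun k L hk hL ξ => ?_⟩
  have hκ : 0 < k * L := mul_pos hk hL
  set a : ℝ := 2 * Real.pi * ‖ξ‖ * L with ha
  have ha0 : 0 ≤ a := by positivity
  set I : ℂ := ∫ r in (0 : ℝ)..2, (radialCutoff r : ℂ) * hankelH0 (k * L * r) *
    Real.cos (a * r) with hI
  have hF : 𝓕 (truncatedKernel 1 k L 0) ξ = (L : ℂ) * (Complex.I / 2 * I) := by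
    have hg := integrableOn_radialCutoff_kernelProfile (d := 1) (Or.inl rfl) hk hL
    rw [truncatedKernel_zero_eq, fourier_radial_line
      (fun r => (radialCutoff (r / L) : ℂ) * kernelProfile 1 k r) (by
      refine hg.congr_fun (fun r _ => ?_) measurableSet_Ioi
      simp)]
    have h1 : ∀ r ∈ Set.Ioi (0 : ℝ), 2 * (((radialCutoff (r / L) : ℂ) * kernelProfile 1 k r) *
        Real.cos (2 * Real.pi * ‖ξ‖ * r)) = radialCutoff (r / L) * (Complex.I / 2 *
          (hankelH0 (k * r) * Real.cos (2 * Real.pi * ‖ξ‖ * r))) := by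
      intro r _
      rw [kernelProfile, if_neg (by norm_num)]
      ring
    rw [setIntegral_congr_fun measurableSet_Ioi h1, integral_radialCutoff_scale hL, hI,
      ← intervalIntegral.integral_const_mul (Complex.I / 2)]
    congr 1
    refine intervalIntegral.integral_congr fun r _ => ?_
    simp only [ha]
    ring_nf
  have hs := Real.sqrt_nonneg (k * L)
  have hlog := log_two_le_log_two_add_inv hκ
  set l := Real.log (2 + (k * L)⁻¹) with hl
  have hn : ‖I‖ * (k * L + a) ≤ 2 * ((2 * C₁ + C₂) * (l * (1 + √(k * L)))) := by
    refine mul_add_le_two_mul_of_bounds (norm_nonneg _) (fun _ => ?_) fun h => ?_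
    · refine (H₁ (k * L) a hκ).trans ?_
      have e1 : √(k * L) ≤ 2 * (l * (1 + √(k * L))) := by nlinarith
      have e2 : C₁ * √(k * L) ≤ C₁ * (2 * (l * (1 + √(k * L)))) := by gcongr
      have e3 : 0 ≤ C₂ * (l * (1 + √(k * L))) := by positivity
      linarith
    · refine (H₂ (k * L) a hκ h).trans ?_
      gcongr
      linarith
  have h2 : ‖Complex.I / 2‖ ≤ 1 := by norm_num
  rw [hF, norm_mul, norm_mul, norm_mul, Complex.norm_real, Real.norm_eq_abs, abs_of_pos hL,
    boundFactor, if_neg (by norm_num), ← Real.sqrt_eq_rpow]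
  calc L * (‖Complex.I / 2‖ * ‖I‖) * ‖besselSymbol k 1 ξ‖
      ≤ L * (1 * ‖I‖) * (k + 2 * Real.pi * ‖ξ‖) := by
        gcongr
        exact norm_besselSymbol_one_le hk ξ
    _ = ‖I‖ * (k * L + a) := by rw [ha]; ring
    _ ≤ _ := by nlinarith

/-- The symbol of the truncated single-layer operator is bounded by `(k² + |2πξ|²)^(-1/2)`, up to the
factor `boundFactor d (k L)`. -/
theorem exists_bound_symbol {d : ℕ} (hd : d = 1 ∨ d = 2) : ∃ C : ℝ, 0 < C ∧ ∀ k L : ℝ, 0 < k →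
    0 < L → ∀ ξ : EuclideanSpace ℝ (Fin d),
      ‖𝓕 (truncatedKernel d k L 0) ξ * besselSymbol k 1 ξ‖ ≤ C * boundFactor d (k * L) := by
  rcases hd with rfl | rfl
  · exact exists_bound_symbol_line
  · exact exists_bound_symbol_plane

theorem diam_pos_of_isOpen {E : Type*} [NormedAddCommGroup E] [NormedSpace ℝ E] [Nontrivial E]
    {U : Set E} (hU : IsOpen U) (hne : U.Nonempty) (hb : Bornology.IsBounded U) :
    0 < Metric.diam U := by
  obtain ⟨x, hx⟩ := hne
  have : (𝓝[≠] x).NeBot := Module.punctured_nhds_neBot ℝ E x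
  exact Metric.diam_pos (infinite_of_mem_nhds x (hU.mem_nhds hx)).nontrivial hb

end ScreenScattering

end

theorem theorem5p2 (d : ℕ) (hd : d = 1 ∨ d = 2) (s : ℝ) :
    ∃ C : ℝ, 0 < C ∧
      ∀ k : ℝ, 0 < k →
      ∀ Γ : TopologicalSpace.Opens (EuclideanSpace ℝ (Fin d)),
        (Γ : Set (EuclideanSpace ℝ (Fin d))).Nonempty →
        Bornology.IsBounded (Γ : Set (EuclideanSpace ℝ (Fin d))) →
        ∃ S : ScreenScattering.sobolevSupportedIn k s
              (closure (Γ : Set (EuclideanSpace ℝ (Fin d)))) →ₗ[ℂ]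
            ScreenScattering.sobolevOn k (s + 1) Γ,
          (∀ φ, ScreenScattering.IsSingleLayerTrace k Γ φ.1.1 (S φ).1) ∧
          ∀ φ, ScreenScattering.sobolevOnNorm (S φ) ≤
            C * ScreenScattering.boundFactor d
                (k * Metric.diam (Γ : Set (EuclideanSpace ℝ (Fin d)))) *
              ScreenScattering.sobolevNorm φ.1 := by
  obtain ⟨C, hC, hCb⟩ := ScreenScattering.exists_bound_symbol hd
  refine ⟨C, hC, fun k hk Γ hne hb => ?_⟩
  have : Nontrivial (EuclideanSpace ℝ (Fin d)) := by
    refine Module.nontrivial_of_finrank_pos (R := ℝ) ?_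
    rw [finrank_euclideanSpace_fin]
    omega
  have hL := ScreenScattering.diam_pos_of_isOpen Γ.isOpen hne hb
  set L := Metric.diam (Γ : Set (EuclideanSpace ℝ (Fin d))) with hLdef
  obtain ⟨R, hR, hGR⟩ := ScreenScattering.exists_integrable_bound_truncatedKernel hd hk hL
  refine ScreenScattering.exists_singleLayer_operator hk s Γ
    (ScreenScattering.truncatedKernel d k L) R _
    (fun t ht => ScreenScattering.contDiff_truncatedKernel d hk L ht)
    (fun t _ => ScreenScattering.hasCompactSupport_truncatedKernel d k hL t) ?_ hR hGR ?_
    (hCb k L hk hL)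
  · intro t _ x hx
    have ho : IsOpen {y : EuclideanSpace ℝ (Fin d) | ‖x - y‖ ^ 2 < 2 * L ^ 2} :=
      isOpen_lt (by fun_prop) continuous_const
    have hsub : closure (Γ : Set (EuclideanSpace ℝ (Fin d))) ⊆ {y | ‖x - y‖ ^ 2 < 2 * L ^ 2} := by
      intro y hy
      have h1 : ‖x - y‖ ≤ L := by
        rw [← dist_eq_norm, hLdef, ← Metric.diam_closure]
        exact Metric.dist_le_diam_of_mem hb.closure (subset_closure hx) hy
      change ‖x - y‖ ^ 2 < 2 * L ^ 2
      nlinarith [norm_nonneg (x - y)]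
    filter_upwards [ho.mem_nhdsSet.2 hsub] with y hy
    exact ScreenScattering.truncatedKernel_eq_fundamentalSolution k t hL hy
  · filter_upwards [Measure.ae_ne volume (0 : EuclideanSpace ℝ (Fin d))] with z hz
    exact ScreenScattering.tendsto_truncatedKernel d hk L hz
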